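/- Let $1\le k<n$ be integers, $1\le p\le\infty$, $1/p+1/p'=1$ (with $1/\infty=0$), and let $\mu,\nu$ be real numbers with $$\nu=\mu-\frac kp,\qquad \mu<\frac{n-k}{p'}.$$ Let $\mathcal G_{n,k}$ be the manifold of all affine $k$-planes $\tau=\xi+u$ in $\mathbb R^n$ ($\xi$ a $k$-dimensional linear subspace, $u\in\xi^\perp$) with the measure $d\tau=d\xi\,du$, where $d\xi$ is the $O(n)$-invariant probability measure on the Grassmannian of $k$-dimensional linear subspaces and $du$ is the Lebesgue measure on $\xi^\perp$. Let $|\tau|$ be the distance from $\tau$ to the origin. For real or complex valued functions let $L^p_\mu(\mathcal G_{n,k})$ and $L^p_\nu(\mathbb R^n)$ be the spaces (of classes of almost everywhere equal measurable functions) with the finite norms $$\|\varphi\|_{p,\mu}=\big\|\,|\tau|^\mu\varphi\,\big\|_{L^p(\mathcal G_{n,k},d\tau)},\qquad \|f\|_{p,\nu}=\big\|\,|x|^\nu f\,\big\|_{L^p(\mathbb R^n,dx)}.$$ The dual $k$-plane transform of a function $\varphi$ on $\mathcal G_{n,k}$ is $$(R_k^*\varphi)(x)=\int_{O(n)}\varphi(\gamma\mathbb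 R^k+x)\,d\gamma,\qquad x\in\mathbb R^n,$$ where $\mathbb R^k=\mathbb R e_1\oplus\dots\oplus\mathbb R e_k$ and $d\gamma$ is the invariant probability measure on $O(n)$. Then for every $\varphi\in L^p_\mu(\mathcal G_{n,k})$ this integral converges absolutely for almost every $x$, the class of $R_k^*\varphi$ depends only on the class of $\varphi$, and $R_k^*$ is a bounded linear operator from $L^p_\mu(\mathcal G_{n,k})$ to $L^p_\nu(\mathbb R^n)$ with the operator norm $$\|R_k^*\|=\pi^{k/2}\left(\frac{\sigma_{n-k-1}}{\sigma_{n-1}}\right)^{1/p'}\frac{\Gamma\big(\tfrac12\big(\tfrac{n-k}{p'}-\mu\big)\big)}{\Gamma\big(\tfrac12\big(\tfrac n{p'}+\tfrac kp-\mu\big)\big)},$$ where $\sigma_{d-1}=2\pi^{d/2}/\Gamma(d/2)$ is the area of the unit sphere in $\mathbb R^d$. -/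

import Mathlib

open MeasureTheory
open scoped ENNReal

noncomputable section

namespace KPlane

/-- The Euclidean space `ℝⁿ`. -/
abbrev E (n : ℕ) : Type := EuclideanSpace ℝ (Fin n)

/-- The orthogonal group `O(n)`, as the group of orthogonal linear operators on `ℝⁿ`
(those `γ` with `γ* γ = γ γ* = 1`), with the operator norm topology and its Borel sets. -/
abbrev O (n : ℕ) : Type := unitary (E n →L[ℝ] E n)

/-- An orthogonal operator preserves the norm. -/
theorem norm_apply {n : ℕ} (γ : O n) (x : E n) : ‖(γ : E n →L[ℝ] E n) x‖ = ‖x‖ :=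
  ContinuousLinearMap.norm_map_of_mem_unitary γ.2 x

/-- An orthogonal operator preserves the inner product. -/
theorem inner_apply {n : ℕ} (γ : O n) (x y : E n) :
    inner ℝ ((γ : E n →L[ℝ] E n) x) ((γ : E n →L[ℝ] E n) y) = inner ℝ x y :=
  ContinuousLinearMap.inner_map_map_of_mem_unitary γ.2 x y

instance instProperEnd (n : ℕ) : ProperSpace (E n →L[ℝ] E n) :=
  FiniteDimensional.proper ℝ _

instance instSecondCountableEnd (n : ℕ) : SecondCountableTopology (E n →L[ℝ] E n) :=
  secondCountable_of_proper

instance instSecondCountableO (n : ℕ) : SecondCountableTopology (O n) :=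
  TopologicalSpace.Subtype.secondCountableTopology _

instance instContinuousStarEnd (n : ℕ) : ContinuousStar (E n →L[ℝ] E n) :=
  ⟨(ContinuousLinearMap.adjoint (𝕜 := ℝ) (E := E n) (F := E n)).continuous⟩

instance instCompactO (n : ℕ) : CompactSpace (O n) := by
  refine isCompact_iff_compactSpace.mp (Metric.isCompact_of_isClosed_isBounded
    (s := (unitary (E n →L[ℝ] E n) : Set (E n →L[ℝ] E n))) ?_ ?_)
  · exact isClosed_unitary
  · refine (Metric.isBounded_closedBall (x := (0 : E n →L[ℝ] E n)) (r := 1)).subset ?_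
    intro γ hγ
    rw [mem_closedBall_zero_iff]
    refine ContinuousLinearMap.opNorm_le_bound _ zero_le_one fun x => ?_
    rw [one_mul]
    exact (norm_apply ⟨γ, hγ⟩ x).le

/-- The invariant probability measure on `O(n)`: the Haar measure of total mass one. -/
def haarO (n : ℕ) : Measure (O n) := Measure.haarMeasure ⊤

instance instProbHaarO (n : ℕ) : IsProbabilityMeasure (haarO n) :=
  ⟨Measure.haarMeasure_self (K₀ := (⊤ : TopologicalSpace.PositiveCompacts (O n)))⟩

instance instHaarO (n : ℕ) : (haarO n).IsHaarMeasure :=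
  Measure.isHaarMeasure_haarMeasure (⊤ : TopologicalSpace.PositiveCompacts (O n))

/-- The set of all (non-oriented) affine `k`-planes in `ℝⁿ`. -/
def AffinePlane (n k : ℕ) : Type :=
  {τ : AffineSubspace ℝ (E n) // (τ : Set (E n)).Nonempty ∧ Module.finrank ℝ τ.direction = k}

/-- Orthonormal `k`-frames in `ℝⁿ`. -/
abbrev Frame (n k : ℕ) : Type := {v : Fin k → E n // Orthonormal ℝ v}

/-- The affine `k`-plane `x + span {v₁, …, v_k}` through `x` spanned by an orthonormal `k`-frame. -/
def AffinePlane.ofFrame {n k : ℕ} (v : Frame n k) (x : E n) :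
    AffinePlane n k :=
  ⟨AffineSubspace.mk' x (Submodule.span ℝ (Set.range v.1)),
    ⟨x, AffineSubspace.self_mem_mk' _ _⟩, by
      rw [AffineSubspace.direction_mk', finrank_span_eq_card v.2.linearIndependent,
        Fintype.card_fin]⟩

/-- The usual topology of the manifold of affine `k`-planes: the quotient topology of
(orthonormal `k`-frames) `× ℝⁿ`. -/
instance instTopAffinePlane (n k : ℕ) : TopologicalSpace (AffinePlane n k) :=
  TopologicalSpace.coinduced (fun q : Frame n k × E n => AffinePlane.ofFrame q.1 q.2)
    instTopologicalSpaceProd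

instance instMeasurableAffinePlane (n k : ℕ) : MeasurableSpace (AffinePlane n k) := borel _

instance instBorelAffinePlane (n k : ℕ) : BorelSpace (AffinePlane n k) := ⟨rfl⟩

/-- `|τ|`, the Euclidean distance from the plane `τ` to the origin. -/
def AffinePlane.dist0 {n k : ℕ} (τ : AffinePlane n k) : ℝ :=
  Metric.infDist (0 : E n) (τ.1 : Set (E n))

/-- The coordinate vectors `e₁, …, e_k` of `ℝⁿ`. -/
def stdFrame {n k : ℕ} (h : k ≤ n) (i : Fin k) : E n := EuclideanSpace.single (Fin.castLE h i) 1

theorem orthonormal_stdFrame {n k : ℕ} (h : k ≤ n) : Orthonormal ℝ (stdFrame h) :=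
  (EuclideanSpace.orthonormal_single (𝕜 := ℝ) (ι := Fin n)).comp _ (Fin.castLE_injective h)

/-- The coordinate `k`-plane `ℝᵏ = ℝ e₁ ⊕ ⋯ ⊕ ℝ e_k` in `ℝⁿ`. -/
def coordPlane {n k : ℕ} (h : k ≤ n) : Submodule ℝ (E n) :=
  Submodule.span ℝ (Set.range (stdFrame h))

/-- The orthonormal frame `γ e₁, …, γ e_k` of the subspace `γ ℝᵏ`, for `γ ∈ O(n)`. -/
def frame {n k : ℕ} (h : k ≤ n) (γ : O n) : Frame n k :=
  ⟨fun i => (γ : E n →L[ℝ] E n) (stdFrame h i), by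
    have h0 := orthonormal_stdFrame h
    rw [orthonormal_iff_ite] at h0 ⊢
    intro i j
    rw [inner_apply]
    exact h0 i j⟩

/-- The affine `k`-plane `γ ℝᵏ + x`, for `γ ∈ O(n)` and `x ∈ ℝⁿ`. -/
def plane {n k : ℕ} (h : k ≤ n) (γ : O n) (x : E n) : AffinePlane n k :=
  AffinePlane.ofFrame (frame h γ) x

/-- The points of `γ ℝᵏ + x` are the `γ y + x` with `y ∈ ℝᵏ`. -/
theorem mem_plane_iff {n k : ℕ} (h : k ≤ n) (γ : O n) (x z : E n) :
    z ∈ (plane h γ x).1 ↔ ∃ y ∈ coordPlane h, z = (γ : E n →L[ℝ] E n) y + x := by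
  have hr : Submodule.span ℝ (Set.range fun i => (γ : E n →L[ℝ] E n) (stdFrame h i)) =
      (coordPlane h).map ((γ : E n →L[ℝ] E n) : E n →ₗ[ℝ] E n) := by
    rw [coordPlane, Submodule.map_span, ← Set.range_comp]
    rfl
  change z ∈ AffineSubspace.mk' x
    (Submodule.span ℝ (Set.range fun i => (γ : E n →L[ℝ] E n) (stdFrame h i))) ↔ _
  rw [AffineSubspace.mem_mk', hr, Submodule.mem_map]
  simp only [vsub_eq_sub, ContinuousLinearMap.coe_coe]
  constructor
  · rintro ⟨y, hy, e⟩
    exact ⟨y, hy, by rw [e]; abel⟩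
  · rintro ⟨y, hy, e⟩
    exact ⟨y, hy, by rw [e]; abel⟩

theorem continuous_apply {n : ℕ} : Continuous fun q : O n × E n => (q.1 : E n →L[ℝ] E n) q.2 :=
  isBoundedBilinearMap_apply.continuous.comp
    ((continuous_subtype_val.comp continuous_fst).prodMk continuous_snd)

theorem continuous_frame {n k : ℕ} (h : k ≤ n) : Continuous (frame h) := by
  refine Continuous.subtype_mk (continuous_pi fun i => ?_) _
  have h2 : Continuous fun γ : O n => ((γ, stdFrame h i) : O n × E n) :=
    continuous_id.prodMk continuous_const
  exact Continuous.comp (g := fun q : O n × E n => (q.1 : E n →L[ℝ] E n) q.2) continuous_apply h2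

theorem continuous_ofFrame {n k : ℕ} :
    Continuous fun q : Frame n k × E n => AffinePlane.ofFrame q.1 q.2 :=
  continuous_coinduced_rng

theorem continuous_plane {n k : ℕ} (h : k ≤ n) :
    Continuous fun q : O n × E n => plane h q.1 q.2 := by
  have h1 : Continuous fun q : O n × E n => frame h q.1 := (continuous_frame h).comp continuous_fst
  have h2 : Continuous fun q : O n × E n => ((frame h q.1, q.2) : Frame n k × E n) :=
    h1.prodMk continuous_snd
  have h3 := continuous_ofFrame.comp h2
  exact h3

/-- The measure `dτ = dξ du` on the affine `k`-planes. The subspace `ξ = γ ℝᵏ` of a random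
`γ ∈ O(n)` follows the `O(n)`-invariant probability measure `dξ` of the Grassmannian, and `γ`
carries the volume of `(ℝᵏ)ᗮ` to the volume `du` of `ξᗮ`; so `dτ` is the image of
(Haar probability) `×` (volume of `(ℝᵏ)ᗮ`) under `(γ, v) ↦ γ ℝᵏ + γ v`, that is,
`∫ φ dτ = ∫_{O(n)} ∫_{(γ ℝᵏ)ᗮ} φ (γ ℝᵏ + u) du dγ`. -/
def planeMeasure {n k : ℕ} (h : k ≤ n) : Measure (AffinePlane n k) :=
  Measure.map
    (fun q : O n × (coordPlane h)ᗮ => plane h q.1 ((q.1 : E n →L[ℝ] E n) (q.2 : E n)))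
    ((haarO n).prod volume)

/-- The map in the definition of `planeMeasure` is measurable. -/
theorem measurable_planeMap {n k : ℕ} (h : k ≤ n) :
    Measurable fun q : O n × (coordPlane h)ᗮ =>
      plane h q.1 ((q.1 : E n →L[ℝ] E n) (q.2 : E n)) := by
  have h2 : Continuous fun q : O n × (coordPlane h)ᗮ => ((q.1, (q.2 : E n)) : O n × E n) :=
    continuous_fst.prodMk (continuous_subtype_val.comp continuous_snd)
  have h3 : Continuous fun q : O n × (coordPlane h)ᗮ => (q.1 : E n →L[ℝ] E n) (q.2 : E n) :=
    Continuous.comp (g := fun q : O n × E n => (q.1 : E n →L[ℝ] E n) q.2) continuous_apply h2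
  have h4 : Continuous fun q : O n × (coordPlane h)ᗮ =>
      ((q.1, (q.1 : E n →L[ℝ] E n) (q.2 : E n)) : O n × E n) := continuous_fst.prodMk h3
  exact (Continuous.comp (g := fun q : O n × E n => plane h q.1 q.2)
    (continuous_plane h) h4).measurable

/-- The dual `k`-plane transform `(R_k^* φ)(x) = ∫_{O(n)} φ (γ ℝᵏ + x) dγ`. -/
def dualTransform {𝕜 : Type*} [RCLike 𝕜] {n k : ℕ} (h : k ≤ n) (φ : AffinePlane n k → 𝕜)
    (x : E n) : 𝕜 :=
  ∫ γ, φ (plane h γ x) ∂(haarO n)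

/-- `sphereArea d = 2 π^{d/2} / Γ(d/2)`, the area `σ_{d-1}` of the unit sphere of `ℝᵈ`. -/
def sphereArea (d : ℕ) : ℝ := 2 * Real.pi ^ ((d : ℝ) / 2) / Real.Gamma ((d : ℝ) / 2)

section WeightedLp

variable {α : Type*} [MeasurableSpace α]

/-- The weighted space `L^p(m; w) = {f : ‖w f‖_p < ∞}` (of almost everywhere equal classes). -/
def WeightedLp (𝕜 : Type*) [RCLike 𝕜] (p : ℝ≥0∞) (m : Measure α) (w : α → ℝ) :
    Submodule 𝕜 (α →ₘ[m] 𝕜) where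
  carrier := {f | MemLp (fun x => w x • f x) p m}
  zero_mem' := by
    refine (memLp_congr_ae ?_).mpr (MemLp.zero' (ε := 𝕜))
    filter_upwards [AEEqFun.coeFn_zero (α := α) (μ := m) (β := 𝕜)] with x hx
    simp [hx]
  add_mem' := by
    intro f g hf hg
    refine (memLp_congr_ae ?_).mpr (MemLp.add hf hg)
    filter_upwards [AEEqFun.coeFn_add f g] with x hx
    simp [hx, smul_add]
  smul_mem' := by
    intro c f hf
    refine (memLp_congr_ae ?_).mpr (MemLp.const_smul hf c)
    filter_upwards [AEEqFun.coeFn_smul c f] with x hx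
    simp only [hx, Pi.smul_apply]
    exact smul_comm (w x) c _

/-- The map `f ↦ w f` from `L^p(m; w)` to `L^p(m)`. -/
def WeightedLp.mulWeight (𝕜 : Type*) [RCLike 𝕜] (p : ℝ≥0∞) (m : Measure α) (w : α → ℝ) :
    WeightedLp 𝕜 p m w →ₗ[𝕜] Lp 𝕜 p m where
  toFun f := MemLp.toLp (fun x => w x • f.1 x) f.2
  map_add' f g := by
    refine Eq.trans ?_ (MemLp.toLp_add f.2 g.2)
    refine (MemLp.toLp_eq_toLp_iff (f + g).2 _).mpr ?_
    filter_upwards [AEEqFun.coeFn_add f.1 g.1] with x hx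
    simp [hx, smul_add]
  map_smul' c f := by
    refine Eq.trans ?_ (MemLp.toLp_const_smul c f.2)
    refine (MemLp.toLp_eq_toLp_iff (c • f).2 _).mpr ?_
    filter_upwards [AEEqFun.coeFn_smul c f.1] with x hx
    simp [hx]

/-- `L^p(m; w)` carries the norm `‖f‖_{p,w} = ‖w f‖_p`. -/
instance WeightedLp.instSeminormed (𝕜 : Type*) [RCLike 𝕜] (p : ℝ≥0∞) [Fact (1 ≤ p)]
    (m : Measure α) (w : α → ℝ) : SeminormedAddCommGroup (WeightedLp 𝕜 p m w) :=
  SeminormedAddCommGroup.induced (WeightedLp 𝕜 p m w) (Lp 𝕜 p m) (WeightedLp.mulWeight 𝕜 p m w)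

instance WeightedLp.instNormedSpace (𝕜 : Type*) [RCLike 𝕜] (p : ℝ≥0∞) [Fact (1 ≤ p)]
    (m : Measure α) (w : α → ℝ) : NormedSpace 𝕜 (WeightedLp 𝕜 p m w) :=
  NormedSpace.induced 𝕜 (WeightedLp 𝕜 p m w) (Lp 𝕜 p m) (WeightedLp.mulWeight 𝕜 p m w)

theorem WeightedLp.norm_def {𝕜 : Type*} [RCLike 𝕜] {p : ℝ≥0∞} [Fact (1 ≤ p)]
    {m : Measure α} {w : α → ℝ} (f : WeightedLp 𝕜 p m w) :
    ‖f‖ = (eLpNorm (fun x => w x • f.1 x) p m).toReal :=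
  Lp.norm_toLp _ f.2

end WeightedLp

/-- `L^p_μ` of the manifold of affine `k`-planes in `ℝⁿ`: the weight is `|τ|^μ`. -/
abbrev PlaneLp (𝕜 : Type*) [RCLike 𝕜] {n k : ℕ} (h : k ≤ n) (p : ℝ≥0∞) (μ : ℝ) :=
  WeightedLp 𝕜 p (planeMeasure h) fun τ : AffinePlane n k => τ.dist0 ^ μ

/-- `L^p_ν(ℝⁿ)`: the weight is `|x|^ν`. -/
abbrev SpaceLp (𝕜 : Type*) [RCLike 𝕜] (n : ℕ) (p : ℝ≥0∞) (ν : ℝ) :=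
  WeightedLp 𝕜 p (volume : Measure (E n)) fun x : E n => ‖x‖ ^ ν

end KPlane

end

/-! Everything rests on one Fubini identity, `lintegral_norm_mul_dual`: integrating `R_k^* G`
against a radial weight `w(|x|)` equals integrating `G(τ)` against the integral of `w` over the
plane `τ`, which depends only on `|τ|`. Since `R_k^*` commutes with rotations and dilations, it maps
`|τ|^a` to a multiple of `|x|^a`; testing the identity on a Gaussian gives the multiplier
(`lintegral_dist0_rpow`).

The upper bound is a Schur test with the critical power `a = -μ - (n-k)/p`. Hölder's inequality in
`γ` splits off `|τ|^a`, whose transform is known, and the identity with a power weight integrates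
the remaining factor (`lintegral_weighted_dual_le`). Hölder is an equality on `|τ|^a`, which
explains sharpness; for `p < ∞` this power just fails to lie in `L^p_μ`. At `p = ∞` a pointwise
bound suffices (`weighted_dual_le_of_ae_le`).

For the lower bound, `|τ|^(a+ε)` is cut off to `|τ| < 1`. Planes through a point of the unit ball
all meet that ball, so the transform there is still an exact power. Both norms blow up at the same
rate in `ε`, and their ratio tends to the claimed constant (`dualConst_mul_le_norm_dualOperator`);
at `p = ∞`, `ε = 0` is allowed. -/

noncomputable section

namespace KPlane

variable {n k : ℕ}

/-! ### Radial integrals and Gamma functions. -/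

section Radial

variable {F : Type*} [NormedAddCommGroup F] [InnerProductSpace ℝ F] [FiniteDimensional ℝ F]
  [MeasurableSpace F] [BorelSpace F]

theorem sphereArea_pos {d : ℕ} (hd : 0 < d) : 0 < sphereArea d := by
  unfold sphereArea
  have : 0 < Real.Gamma ((d : ℝ) / 2) := Real.Gamma_pos_of_pos (by positivity)
  positivity

theorem finrank_mul_volume_ball (hd : 0 < Module.finrank ℝ F) :
    (Module.finrank ℝ F : ℝ) * (volume : Measure F).real (Metric.ball 0 1) =
      sphereArea (Module.finrank ℝ F) := by
  have : Nontrivial F := Module.nontrivial_of_finrank_pos hd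
  set d := Module.finrank ℝ F with hdd
  have hd' : (0 : ℝ) < d := by exact_mod_cast hd
  have hG : 0 < Real.Gamma ((d : ℝ) / 2) := Real.Gamma_pos_of_pos (by positivity)
  rw [Measure.real, InnerProductSpace.volume_ball, ← hdd, sphereArea,
    Real.Gamma_add_one (by positivity)]
  rw [ENNReal.ofReal_one, one_pow, one_mul, ENNReal.toReal_ofReal (by positivity),
    Real.sqrt_eq_rpow, ← Real.rpow_natCast, ← Real.rpow_mul Real.pi_pos.le,
    show 1 / 2 * (d : ℝ) = d / 2 by ring]
  field_simp

/-- Integration of a nonnegative radial function in polar coordinates. -/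
theorem lintegral_radial (hd : 0 < Module.finrank ℝ F) {f : ℝ → ℝ} (hf : ∀ r, 0 ≤ r → 0 ≤ f r)
    (hi : IntegrableOn (fun r => r ^ ((Module.finrank ℝ F : ℝ) - 1) * f r) (Set.Ioi 0)) :
    ∫⁻ x : F, ENNReal.ofReal (f ‖x‖) =
      ENNReal.ofReal (sphereArea (Module.finrank ℝ F) *
        ∫ r in Set.Ioi (0 : ℝ), r ^ ((Module.finrank ℝ F : ℝ) - 1) * f r) := by
  have : Nontrivial F := Module.nontrivial_of_finrank_pos hd
  have e : ∀ r : ℝ, r ^ (Module.finrank ℝ F - 1) • f r =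
      r ^ ((Module.finrank ℝ F : ℝ) - 1) * f r := by
    intro r
    rw [smul_eq_mul, ← Real.rpow_natCast, Nat.cast_sub hd, Nat.cast_one]
  rw [← ofReal_integral_eq_lintegral_ofReal]
  · rw [integral_fun_norm_addHaar volume f, ← finrank_mul_volume_ball hd]
    simp_rw [e]
    rw [nsmul_eq_mul, smul_eq_mul, mul_assoc]
  · rw [integrable_fun_norm_addHaar volume (f := f)]
    simpa only [e] using hi
  · exact Filter.Eventually.of_forall fun x => hf _ (norm_nonneg x)

/-- Used on `ℝⁿ` and on `(ℝᵏ)ᗮ`: the quotient of the two values gives the Gamma quotient in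
`dualConst`. -/
theorem lintegral_norm_rpow_mul_gaussian (hd : 0 < Module.finrank ℝ F) {s : ℝ}
    (hs : -(Module.finrank ℝ F : ℝ) < s) :
    ∫⁻ x : F, ENNReal.ofReal (‖x‖ ^ s * Real.exp (-‖x‖ ^ 2)) =
      ENNReal.ofReal (sphereArea (Module.finrank ℝ F) *
        (Real.Gamma (((Module.finrank ℝ F : ℝ) + s) / 2) / 2)) := by
  set d := Module.finrank ℝ F with hdd
  have e : ∀ r ∈ Set.Ioi (0 : ℝ), r ^ ((d : ℝ) - 1 + s) * Real.exp (-r ^ (2 : ℝ)) =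
      r ^ ((d : ℝ) - 1) * (r ^ s * Real.exp (-r ^ 2)) := by
    intro r hr
    rw [Real.rpow_add hr, mul_assoc, Real.rpow_two]
  rw [lintegral_radial (F := F) hd (f := fun r => r ^ s * Real.exp (-r ^ 2)), ← hdd,
    ← setIntegral_congr_fun measurableSet_Ioi e,
    integral_rpow_mul_exp_neg_rpow two_pos (by linarith)]
  · congr 2
    rw [show (d : ℝ) - 1 + s + 1 = d + s by ring]
    ring
  · intro r hr; positivity
  · refine IntegrableOn.congr_fun ?_ e measurableSet_Ioi
    exact integrableOn_rpow_mul_exp_neg_rpow (by linarith) (by norm_num)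

/-- Supplies the norms of the cut-off powers; `s` measures the distance from the critical,
non-integrable exponent. -/
theorem lintegral_norm_rpow_unitBall (hd : 0 < Module.finrank ℝ F) {s : ℝ} (hs : 0 < s) :
    ∫⁻ x : F, ENNReal.ofReal (if ‖x‖ < 1 then ‖x‖ ^ (s - (Module.finrank ℝ F : ℝ)) else 0) =
      ENNReal.ofReal (sphereArea (Module.finrank ℝ F) / s) := by
  set d := Module.finrank ℝ F with hdd
  have e : ∀ r ∈ Set.Ioi (0 : ℝ), (Set.Ioo (0 : ℝ) 1).indicator (fun r => r ^ (s - 1)) r =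
      r ^ ((d : ℝ) - 1) * (if r < 1 then r ^ (s - (d : ℝ)) else 0) := by
    intro r hr
    have hr : 0 < r := hr
    by_cases h : r < 1
    · rw [Set.indicator_of_mem (by exact ⟨hr, h⟩), if_pos h, ← Real.rpow_add hr]
      congr 1; ring
    · rw [Set.indicator_of_notMem (by exact fun h' => h h'.2), if_neg h, mul_zero]
  have hii : IntervalIntegrable (fun r : ℝ => r ^ (s - 1)) volume 0 1 :=
    intervalIntegral.intervalIntegrable_rpow' (by linarith)
  have hI : IntegrableOn (fun r : ℝ => r ^ (s - 1)) (Set.Ioo 0 1) :=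
    (intervalIntegrable_iff_integrableOn_Ioo_of_le zero_le_one).mp hii
  rw [lintegral_radial (F := F) hd (f := fun r => if r < 1 then r ^ (s - (d : ℝ)) else 0), ← hdd,
    ← setIntegral_congr_fun measurableSet_Ioi e]
  · rw [setIntegral_indicator measurableSet_Ioo,
      Set.inter_eq_right.mpr Set.Ioo_subset_Ioi_self, ← integral_Ioc_eq_integral_Ioo,
      ← intervalIntegral.integral_of_le zero_le_one, integral_rpow (Or.inl (by linarith))]
    simp [hs.ne', div_eq_mul_inv]
  · intro r hr
    split_ifs <;> positivity
  · refine IntegrableOn.congr_fun ?_ e measurableSet_Ioi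
    exact (hI.integrable_indicator measurableSet_Ioo).integrableOn

theorem ofReal_rpow_neg_eq_lintegral {a c : ℝ} (ha : 0 < a) (hc : 0 < c) :
    ENNReal.ofReal (c ^ (-a)) = ENNReal.ofReal (Real.Gamma a)⁻¹ *
      ∫⁻ t in Set.Ioi (0 : ℝ), ENNReal.ofReal (t ^ (a - 1) * Real.exp (-(c * t))) := by
  have hG := Real.Gamma_pos_of_pos ha
  rw [← ofReal_integral_eq_lintegral_ofReal]
  · rw [Real.integral_rpow_mul_exp_neg_mul_Ioi ha hc, ← ENNReal.ofReal_mul (by positivity),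
      one_div, Real.inv_rpow hc.le, Real.rpow_neg hc.le]
    congr 1
    field_simp
  · have := integrableOn_rpow_mul_exp_neg_mul_rpow (s := a - 1) (p := 1) (b := c)
      (by linarith) one_pos hc
    simp only [Real.rpow_one, neg_mul] at this
    exact this
  · filter_upwards [ae_restrict_mem measurableSet_Ioi] with t ht
    have : 0 < t := ht
    simp only [Pi.zero_apply]
    positivity

theorem lintegral_gaussian {t : ℝ} (ht : 0 < t) :
    ∫⁻ y : F, ENNReal.ofReal (Real.exp (-(t * ‖y‖ ^ 2))) =
      ENNReal.ofReal ((Real.pi / t) ^ ((Module.finrank ℝ F : ℝ) / 2)) := by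
  have e := GaussianFourier.integral_rexp_neg_mul_sq_norm (V := F) ht
  simp only [neg_mul] at e
  rw [← e, ofReal_integral_eq_lintegral_ofReal]
  -- Integrability comes for free: a non-integrable function has Bochner integral 0, whereas the
  -- known value is positive.
  · by_contra h
    rw [integral_undef h] at e
    have : 0 < (Real.pi / t) ^ ((Module.finrank ℝ F : ℝ) / 2) := by positivity
    linarith
  · exact Filter.Eventually.of_forall fun _ => (Real.exp_pos _).le

/-- Subordination: a Gamma integral in `t` turns the power into a superposition of Gaussians in `y`.
Integrating in `y` first costs a factor `t^(-d/2)`, and a second Gamma integral remains; it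
converges because `b < -d`. -/
theorem lintegral_rpow_add_norm_sq {b r : ℝ} (hr : 0 < r)
    (hb : b < -(Module.finrank ℝ F : ℝ)) :
    ∫⁻ y : F, ENNReal.ofReal (Real.sqrt (r ^ 2 + ‖y‖ ^ 2) ^ b) =
      ENNReal.ofReal (Real.pi ^ ((Module.finrank ℝ F : ℝ) / 2) *
        (Real.Gamma (-(b + Module.finrank ℝ F) / 2) / Real.Gamma (-b / 2)) *
          r ^ (b + (Module.finrank ℝ F : ℝ))) := by
  set d := Module.finrank ℝ F with hdd
  have hd0 : (0 : ℝ) ≤ d := by positivity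
  have ha : 0 < -b / 2 := by linarith
  have ha' : 0 < -(b + d) / 2 := by linarith
  have hG := Real.Gamma_pos_of_pos ha
  have e1 : ∀ y : F, ENNReal.ofReal (Real.sqrt (r ^ 2 + ‖y‖ ^ 2) ^ b) =
      ENNReal.ofReal (Real.Gamma (-b / 2))⁻¹ * ∫⁻ t in Set.Ioi (0 : ℝ),
        ENNReal.ofReal (t ^ (-b / 2 - 1) * Real.exp (-((r ^ 2 + ‖y‖ ^ 2) * t))) := by
    intro y
    have hc : 0 < r ^ 2 + ‖y‖ ^ 2 := by positivity
    rw [← ofReal_rpow_neg_eq_lintegral ha hc, Real.sqrt_eq_rpow, ← Real.rpow_mul hc.le]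
    congr 2; ring
  have e2 : ∀ t ∈ Set.Ioi (0 : ℝ), ∫⁻ y : F,
      ENNReal.ofReal (t ^ (-b / 2 - 1) * Real.exp (-((r ^ 2 + ‖y‖ ^ 2) * t))) =
      ENNReal.ofReal (Real.pi ^ ((d : ℝ) / 2)) *
        ENNReal.ofReal (t ^ (-(b + d) / 2 - 1) * Real.exp (-(r ^ 2 * t))) := by
    intro t ht
    have ht : 0 < t := ht
    have e3 : ∀ y : F,
        ENNReal.ofReal (t ^ (-b / 2 - 1) * Real.exp (-((r ^ 2 + ‖y‖ ^ 2) * t))) =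
        ENNReal.ofReal (t ^ (-b / 2 - 1) * Real.exp (-(r ^ 2 * t))) *
          ENNReal.ofReal (Real.exp (-(t * ‖y‖ ^ 2))) := by
      intro y
      rw [← ENNReal.ofReal_mul (by positivity), mul_assoc, ← Real.exp_add]
      congr 3; ring
    simp_rw [e3]
    rw [lintegral_const_mul' _ _ ENNReal.ofReal_ne_top, lintegral_gaussian ht, ← hdd,
      ← ENNReal.ofReal_mul (by positivity), ← ENNReal.ofReal_mul (by positivity)]
    congr 1
    rw [Real.div_rpow Real.pi_pos.le ht.le,
      show -(b + d) / 2 - 1 = (-b / 2 - 1) + (-(d / 2)) by ring, Real.rpow_add ht,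
      Real.rpow_neg ht.le (d / 2)]
    ring
  simp_rw [e1]
  rw [lintegral_const_mul' _ _ ENNReal.ofReal_ne_top, lintegral_lintegral_swap]
  · rw [setLIntegral_congr_fun measurableSet_Ioi e2,
      lintegral_const_mul' _ _ ENNReal.ofReal_ne_top]
    have e4 := ofReal_rpow_neg_eq_lintegral ha' (pow_pos hr 2)
    have hG' := Real.Gamma_pos_of_pos ha'
    have e5 : ∫⁻ t in Set.Ioi (0 : ℝ), ENNReal.ofReal
        (t ^ (-(b + d) / 2 - 1) * Real.exp (-(r ^ 2 * t))) =
        ENNReal.ofReal (Real.Gamma (-(b + d) / 2)) *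
          ENNReal.ofReal ((r ^ 2) ^ (-(-(b + d) / 2))) := by
      rw [e4, ← mul_assoc, ← ENNReal.ofReal_mul hG'.le, mul_inv_cancel₀ hG'.ne',
        ENNReal.ofReal_one, one_mul]
    rw [e5, ← ENNReal.ofReal_mul hG'.le, ← ENNReal.ofReal_mul (by positivity),
      ← ENNReal.ofReal_mul (by positivity), ← Real.rpow_natCast, ← Real.rpow_mul hr.le]
    congr 1
    rw [show ((2 : ℕ) : ℝ) * -(-(b + d) / 2) = b + d by push_cast; ring]
    field_simp
  · refine Measurable.aemeasurable ?_
    refine ENNReal.measurable_ofReal.comp ?_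
    fun_prop

end Radial

/-! ### Distance to the origin and the action of `O(n)` on planes. -/

theorem infDist_zero_eq_norm (τ : AffineSubspace ℝ (E n)) {w : E n} (hw : w ∈ τ)
    (ho : ∀ s ∈ τ.direction, inner ℝ w s = 0) :
    Metric.infDist (0 : E n) (τ : Set (E n)) = ‖w‖ := by
  refine le_antisymm ?_ ?_
  · have := Metric.infDist_le_dist_of_mem (x := (0 : E n)) (s := (τ : Set (E n))) hw
    simpa using this
  · rw [Metric.le_infDist ⟨w, hw⟩]
    intro z hz
    have h1 := ho _ (AffineSubspace.vsub_mem_direction hz hw)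
    have h2 : ‖z‖ * ‖z‖ = ‖w‖ * ‖w‖ + ‖z - w‖ * ‖z - w‖ := by
      rw [← norm_add_sq_eq_norm_sq_add_norm_sq_of_inner_eq_zero w (z - w) h1]
      simp
    rw [dist_zero_left]
    nlinarith [norm_nonneg z, norm_nonneg w, mul_self_nonneg ‖z - w‖]

/-- This formula is continuous in frame and point, hence `|τ|` is continuous for the quotient
topology. -/
theorem dist0_ofFrame (v : Frame n k) (x : E n) :
    (AffinePlane.ofFrame v x).dist0 = ‖x - ∑ i, inner ℝ (v.1 i) x • v.1 i‖ := by
  refine infDist_zero_eq_norm _ ?_ ?_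
  · change _ ∈ AffineSubspace.mk' x (Submodule.span ℝ (Set.range v.1))
    rw [AffineSubspace.mem_mk', vsub_eq_sub, sub_sub_cancel_left, Submodule.neg_mem_iff]
    exact Submodule.sum_mem _ fun i _ =>
      Submodule.smul_mem _ _ (Submodule.subset_span ⟨i, rfl⟩)
  · intro s hs
    change s ∈ (AffineSubspace.mk' x (Submodule.span ℝ (Set.range v.1))).direction at hs
    rw [AffineSubspace.direction_mk'] at hs
    induction hs using Submodule.span_induction with
    | mem s hs =>
      obtain ⟨j, rfl⟩ := hs
      rw [inner_sub_left, sum_inner]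
      simp_rw [inner_smul_left, orthonormal_iff_ite.mp v.2]
      simp [real_inner_comm]
    | zero => simp
    | add a b _ _ ha hb => rw [inner_add_right, ha, hb, add_zero]
    | smul c a _ ha => rw [inner_smul_right, ha, mul_zero]

theorem continuous_dist0 : Continuous (AffinePlane.dist0 : AffinePlane n k → ℝ) := by
  refine continuous_coinduced_dom.mpr ?_
  have : (AffinePlane.dist0 ∘ fun q : Frame n k × E n => AffinePlane.ofFrame q.1 q.2) =
      fun q : Frame n k × E n => ‖q.2 - ∑ i, inner ℝ (q.1.1 i) q.2 • q.1.1 i‖ :=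
    funext fun q => dist0_ofFrame q.1 q.2
  rw [this]
  have h : ∀ i, Continuous fun q : Frame n k × E n => q.1.1 i := fun i =>
    (_root_.continuous_apply i).comp (continuous_subtype_val.comp continuous_fst)
  fun_prop

theorem measurable_dist0 : Measurable (AffinePlane.dist0 : AffinePlane n k → ℝ) :=
  continuous_dist0.measurable

theorem dist0_nonneg (τ : AffinePlane n k) : 0 ≤ τ.dist0 := Metric.infDist_nonneg

theorem inv_apply_apply (γ : O n) (x : E n) :
    ((γ⁻¹ : O n) : E n →L[ℝ] E n) ((γ : E n →L[ℝ] E n) x) = x := by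
  rw [← mul_apply_eq_comp, ← Submonoid.coe_mul, inv_mul_cancel]
  rfl

theorem apply_inv_apply (γ : O n) (x : E n) :
    (γ : E n →L[ℝ] E n) (((γ⁻¹ : O n) : E n →L[ℝ] E n) x) = x := by
  rw [← mul_apply_eq_comp, ← Submonoid.coe_mul, mul_inv_cancel]
  rfl

/-- Shifting along the plane does not change the plane. -/
theorem plane_add (h : k ≤ n) (γ : O n) {y : E n} (hy : y ∈ coordPlane h) (x : E n) :
    plane h γ ((γ : E n →L[ℝ] E n) y + x) = plane h γ x := by
  refine Subtype.ext (AffineSubspace.ext fun z => ?_)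
  rw [mem_plane_iff, mem_plane_iff]
  constructor
  · rintro ⟨w, hw, rfl⟩
    exact ⟨w + y, add_mem hw hy, by rw [map_add]; abel⟩
  · rintro ⟨w, hw, rfl⟩
    exact ⟨w - y, sub_mem hw hy, by rw [map_sub]; abel⟩

theorem dist0_plane_orthogonal (h : k ≤ n) (γ : O n) {u : E n} (hu : u ∈ (coordPlane h)ᗮ) :
    (plane h γ ((γ : E n →L[ℝ] E n) u)).dist0 = ‖u‖ := by
  have hm : (γ : E n →L[ℝ] E n) u ∈ (plane h γ ((γ : E n →L[ℝ] E n) u)).1 :=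
    (mem_plane_iff h γ _ _).mpr ⟨0, zero_mem _, by simp⟩
  rw [AffinePlane.dist0, infDist_zero_eq_norm _ hm, norm_apply]
  intro s hs
  have h2 : s + (γ : E n →L[ℝ] E n) u ∈ (plane h γ ((γ : E n →L[ℝ] E n) u)).1 :=
    AffineSubspace.vadd_mem_of_mem_direction hs hm
  obtain ⟨y, hy, e⟩ := (mem_plane_iff h γ _ _).mp h2
  rw [add_right_cancel e, inner_apply, real_inner_comm]
  exact hu y hy

/-- Only the component of `γ⁻¹ x` orthogonal to `ℝᵏ` moves the plane. Homogeneity, invariance and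
`|τ| ≤ |x|` can be read off from this form. -/
theorem dist0_plane (h : k ≤ n) (γ : O n) (x : E n) :
    (plane h γ x).dist0 =
      ‖(coordPlane h)ᗮ.orthogonalProjectionOnto (((γ⁻¹ : O n) : E n →L[ℝ] E n) x)‖ := by
  set z := ((γ⁻¹ : O n) : E n →L[ℝ] E n) x with hz
  have e : x = (γ : E n →L[ℝ] E n) ((coordPlane h).orthogonalProjectionOnto z : E n) +
      (γ : E n →L[ℝ] E n) ((coordPlane h)ᗮ.orthogonalProjectionOnto z : E n) := by
    rw [← map_add]
    have := (coordPlane h).starProjection_add_starProjection_orthogonal z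
    rw [Submodule.starProjection_apply, Submodule.starProjection_apply] at this
    rw [this, hz, apply_inv_apply]
  conv_lhs => rw [e]
  rw [plane_add h γ (Submodule.coe_mem _), dist0_plane_orthogonal h γ (Submodule.coe_mem _)]
  rfl

theorem dist0_plane_le (h : k ≤ n) (γ : O n) (x : E n) : (plane h γ x).dist0 ≤ ‖x‖ := by
  rw [dist0_plane]
  refine (Submodule.norm_orthogonalProjectionOnto_apply_le _ _).trans ?_
  rw [norm_apply]

theorem dist0_plane_smul (h : k ≤ n) (γ : O n) {r : ℝ} (hr : 0 ≤ r) (x : E n) :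
    (plane h γ (r • x)).dist0 = r * (plane h γ x).dist0 := by
  rw [dist0_plane, dist0_plane, map_smul, map_smul, norm_smul, Real.norm_of_nonneg hr]

theorem dist0_plane_mul (h : k ≤ n) (δ γ : O n) (x : E n) :
    (plane h (δ * γ) ((δ : E n →L[ℝ] E n) x)).dist0 = (plane h γ x).dist0 := by
  rw [dist0_plane, dist0_plane, mul_inv_rev, Submonoid.coe_mul, mul_apply_eq_comp,
    inv_apply_apply]

theorem exists_apply_eq {x y : E n} (hxy : ‖x‖ = ‖y‖) :
    ∃ δ : O n, (δ : E n →L[ℝ] E n) x = y := by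
  refine ⟨Unitary.linearIsometryEquiv.symm (Submodule.reflection (Submodule.span ℝ {x - y})ᗮ), ?_⟩
  exact Submodule.reflection_sub hxy

theorem measurePreserving_apply (γ : O n) :
    MeasurePreserving (fun x : E n => (γ : E n →L[ℝ] E n) x) :=
  (Unitary.linearIsometryEquiv γ).measurePreserving

theorem finrank_coordPlane (h : k ≤ n) : Module.finrank ℝ (coordPlane h) = k := by
  rw [coordPlane, finrank_span_eq_card (orthonormal_stdFrame h).linearIndependent,
    Fintype.card_fin]

theorem finrank_coordPlane_orthogonal (h : k ≤ n) :
    Module.finrank ℝ (coordPlane h)ᗮ = n - k := by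
  have := (coordPlane h).finrank_add_finrank_orthogonal
  rw [finrank_coordPlane, finrank_euclideanSpace, Fintype.card_fin] at this
  omega

/-! ### Fubini along planes and null sets. -/

theorem measurePreserving_add_orthogonal (V : Submodule ℝ (E n)) :
    MeasurePreserving (fun q : V × Vᗮ => (q.1 : E n) + (q.2 : E n)) (volume.prod volume) volume :=
  V.orthogonalDecomposition.symm.measurePreserving.comp (WithLp.volume_preserving_toLp V Vᗮ)

theorem lintegral_eq_lintegral_orthogonal (V : Submodule ℝ (E n)) {f : E n → ℝ≥0∞}
    (hf : Measurable f) :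
    ∫⁻ x, f x = ∫⁻ u : Vᗮ, ∫⁻ y : V, f (y + u) := by
  rw [← (measurePreserving_add_orthogonal V).lintegral_comp hf]
  exact lintegral_prod_symm _
    (hf.comp (measurePreserving_add_orthogonal V).measurable).aemeasurable

theorem norm_add_orthogonal {V : Submodule ℝ (E n)} (y : V) (u : Vᗮ) :
    ‖(y : E n) + (u : E n)‖ = Real.sqrt (‖u‖ ^ 2 + ‖y‖ ^ 2) := by
  refine (Real.sqrt_eq_iff_mul_self_eq (by positivity) (norm_nonneg _) |>.mpr ?_).symm
  rw [norm_add_sq_eq_norm_sq_add_norm_sq_of_inner_eq_zero _ _ (u.2 _ y.2)]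
  simp only [Submodule.coe_norm]
  ring

theorem measurable_plane (h : k ≤ n) : Measurable fun q : O n × E n => plane h q.1 q.2 :=
  (continuous_plane h).measurable

theorem measurable_plane_swap (h : k ≤ n) : Measurable fun q : E n × O n => plane h q.2 q.1 := by
  have := (measurable_plane h).comp (measurable_swap (α := E n) (β := O n))
  exact this

theorem measurable_plane_left (h : k ≤ n) (x : E n) : Measurable fun γ : O n => plane h γ x := by
  have h1 : Measurable fun γ : O n => (γ, x) := measurable_prodMk_right
  have := (measurable_plane h).comp h1
  exact this

theorem lintegral_planeMeasure (h : k ≤ n) {G : AffinePlane n k → ℝ≥0∞} (hG : Measurable G) :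
    ∫⁻ τ, G τ ∂(planeMeasure h) = ∫⁻ γ, (∫⁻ u : (coordPlane h)ᗮ,
      G (plane h γ ((γ : E n →L[ℝ] E n) u))) ∂(haarO n) := by
  rw [planeMeasure, lintegral_map hG (measurable_planeMap h)]
  exact lintegral_prod _ (hG.comp (measurable_planeMap h)).aemeasurable

theorem lintegral_dist0_planeMeasure (h : k ≤ n) {g : ℝ → ℝ≥0∞} (hg : Measurable g) :
    ∫⁻ τ, g τ.dist0 ∂(planeMeasure h) = ∫⁻ u : (coordPlane h)ᗮ, g ‖u‖ := by
  rw [lintegral_planeMeasure h (G := fun τ => g τ.dist0) (hg.comp measurable_dist0)]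
  simp_rw [fun (γ : O n) (u : (coordPlane h)ᗮ) => dist0_plane_orthogonal h γ u.2]
  simp

/-- For fixed `γ`, substitute `γ x` for `x` and split `x = y + u` along `ℝᵏ ⊕ (ℝᵏ)ᗮ`: the plane sees
only `u`, while `|x|² = |u|² + |y|²` and `|u| = |τ|`. -/
theorem lintegral_norm_mul_dual (h : k ≤ n) {w : ℝ → ℝ≥0∞} (hw : Measurable w)
    {G : AffinePlane n k → ℝ≥0∞} (hG : Measurable G) :
    ∫⁻ x : E n, w ‖x‖ * ∫⁻ γ, G (plane h γ x) ∂(haarO n) =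
      ∫⁻ τ, G τ * (∫⁻ y : coordPlane h, w (Real.sqrt (τ.dist0 ^ 2 + ‖y‖ ^ 2)))
        ∂(planeMeasure h) := by
  have hm : Measurable fun q : E n × O n => w ‖q.1‖ * G (plane h q.2 q.1) := by
    have h1 := hG.comp (measurable_plane_swap h)
    have h2 : Measurable fun q : E n × O n => w ‖q.1‖ := hw.comp measurable_fst.norm
    have := h2.mul h1
    exact this
  have hm2 : Measurable fun τ : AffinePlane n k =>
      ∫⁻ y : coordPlane h, w (Real.sqrt (τ.dist0 ^ 2 + ‖y‖ ^ 2)) := by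
    have h0 : Measurable fun q : AffinePlane n k × coordPlane h =>
        Real.sqrt (q.1.dist0 ^ 2 + ‖q.2‖ ^ 2) :=
      (((measurable_dist0.comp measurable_fst).pow_const 2).add
        (measurable_snd.norm.pow_const 2)).sqrt
    exact (hw.comp h0).lintegral_prod_right'
  have e1 : ∀ x : E n, w ‖x‖ * ∫⁻ γ, G (plane h γ x) ∂(haarO n) =
      ∫⁻ γ, w ‖x‖ * G (plane h γ x) ∂(haarO n) := fun x =>
    (lintegral_const_mul _ (hG.comp (measurable_plane_left h x))).symm
  simp_rw [e1]
  rw [lintegral_lintegral_swap hm.aemeasurable,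
    lintegral_planeMeasure h
      (G := fun τ => G τ * ∫⁻ y : coordPlane h, w (Real.sqrt (τ.dist0 ^ 2 + ‖y‖ ^ 2)))
      (hG.mul hm2)]
  refine lintegral_congr fun γ => ?_
  have hmγ : Measurable fun x : E n => w ‖x‖ * G (plane h γ x) := by
    have h1 : Measurable fun x : E n => (x, γ) := measurable_prodMk_right
    have := hm.comp h1
    exact this
  have hmγ' := hmγ.comp (measurePreserving_apply γ).measurable
  rw [← (measurePreserving_apply γ).lintegral_comp hmγ]
  refine (lintegral_eq_lintegral_orthogonal (coordPlane h) hmγ').trans ?_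
  refine lintegral_congr fun u => ?_
  rw [← lintegral_const_mul _ (by fun_prop)]
  refine lintegral_congr fun y => ?_
  simp only [Function.comp_apply]
  rw [norm_apply, norm_add_orthogonal, map_add, plane_add h γ y.2, dist0_plane_orthogonal h γ u.2,
    mul_comm]
  rfl

/-- A property of almost all planes holds, for almost every `x`, for almost all planes
through `x`. -/
theorem ae_ae_plane (h : k ≤ n) {P : AffinePlane n k → Prop}
    (hP : ∀ᵐ τ ∂(planeMeasure h), P τ) :
    ∀ᵐ x : E n, ∀ᵐ γ ∂(haarO n), P (plane h γ x) := by
  obtain ⟨N, hN, hNm, hN0⟩ := exists_measurable_superset_of_null (ae_iff.mp hP)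
  have hG : Measurable (N.indicator fun _ => (1 : ℝ≥0∞)) := measurable_const.indicator hNm
  -- With weight 1 the integral over `ℝᵏ` may be infinite; this is harmless, since the indicator
  -- vanishes almost everywhere and `0 * ∞ = 0`.
  have e := lintegral_norm_mul_dual h (w := fun _ => 1) measurable_const hG
  have hz : ∀ᵐ τ ∂(planeMeasure h), τ ∉ N := measure_eq_zero_iff_ae_notMem.mp hN0
  have e0 : ∫⁻ τ, N.indicator (fun _ => (1 : ℝ≥0∞)) τ * (∫⁻ _ : coordPlane h, 1)
      ∂(planeMeasure h) = 0 := by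
    refine (lintegral_congr_ae (g := fun _ => 0) ?_).trans lintegral_zero
    filter_upwards [hz] with τ hτ
    rw [Set.indicator_of_notMem hτ, zero_mul]
  rw [e0, lintegral_eq_zero_iff] at e
  · filter_upwards [e] with x hx
    simp only [one_mul, Pi.zero_apply] at hx
    rw [lintegral_eq_zero_iff (f := fun γ => N.indicator (fun _ => (1 : ℝ≥0∞)) (plane h γ x))
      (hG.comp (measurable_plane_left h x))] at hx
    filter_upwards [hx] with γ hγ
    by_contra hc
    have : plane h γ x ∈ N := hN hc
    simp [Set.indicator_of_mem this] at hγ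
  · simp only [one_mul]
    exact (hG.comp (measurable_plane_swap h)).lintegral_prod_right'

/-- Permits cancelling powers of `|τ|` almost everywhere. The strict inequality `k < n` matters: it
makes `(ℝᵏ)ᗮ` nontrivial. -/
theorem ae_dist0_pos (h : k < n) : ∀ᵐ τ ∂(planeMeasure h.le), 0 < τ.dist0 := by
  have hs : MeasurableSet {τ : AffinePlane n k | 0 < τ.dist0} :=
    measurableSet_lt measurable_const measurable_dist0
  rw [planeMeasure, ae_map_iff (measurable_planeMap h.le).aemeasurable hs]
  have : Nontrivial (coordPlane h.le)ᗮ := by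
    refine Module.nontrivial_of_finrank_pos (R := ℝ) ?_
    rw [finrank_coordPlane_orthogonal]
    omega
  have h0 : ∀ᵐ u : (coordPlane h.le)ᗮ, u ≠ 0 := Measure.ae_ne volume 0
  filter_upwards [Measure.quasiMeasurePreserving_snd.ae h0] with q hq
  rw [dist0_plane_orthogonal h.le q.1 q.2.2]
  exact norm_pos_iff.mpr (by simpa using hq)

/-! ### The dual transform of powers of the distance. -/

/-- The factor by which `R_k^*` maps `|τ|^a` to a multiple of `|x|^a`. -/
def dualConst (n k : ℕ) (a : ℝ) : ℝ :=
  Real.pi ^ ((k : ℝ) / 2) * (sphereArea (n - k) / sphereArea n) *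
    (Real.Gamma ((n - k + a) / 2) / Real.Gamma ((n + a) / 2))

theorem dualConst_pos (h : k < n) {a : ℝ} (ha : -((n : ℝ) - k) < a) : 0 < dualConst n k a := by
  have h1 := sphereArea_pos (Nat.sub_pos_of_lt h)
  have h2 := sphereArea_pos (Nat.zero_lt_of_lt h)
  have h3 : 0 < Real.Gamma (((n : ℝ) - k + a) / 2) := Real.Gamma_pos_of_pos (by linarith)
  have hk : (0 : ℝ) ≤ k := by positivity
  have h4 : 0 < Real.Gamma (((n : ℝ) + a) / 2) := Real.Gamma_pos_of_pos (by linarith)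
  unfold dualConst
  positivity

/-- The dual transform of `|τ|^a`, as an integral with values in `[0, ∞]`. -/
def dualPower (h : k ≤ n) (a : ℝ) (x : E n) : ℝ≥0∞ :=
  ∫⁻ γ, ENNReal.ofReal ((plane h γ x).dist0 ^ a) ∂(haarO n)

theorem measurable_dist0_rpow (a : ℝ) :
    Measurable fun τ : AffinePlane n k => ENNReal.ofReal (τ.dist0 ^ a) :=
  (measurable_dist0.pow_const a).ennreal_ofReal

/-- Left invariance of Haar measure absorbs the rotation. -/
theorem dualPower_apply (h : k ≤ n) (a : ℝ) (δ : O n) (x : E n) :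
    dualPower h a ((δ : E n →L[ℝ] E n) x) = dualPower h a x := by
  unfold dualPower
  rw [← lintegral_mul_left_eq_self _ δ]
  simp_rw [dist0_plane_mul]

theorem dualPower_smul (h : k ≤ n) (a : ℝ) {r : ℝ} (hr : 0 ≤ r) (x : E n) :
    dualPower h a (r • x) = ENNReal.ofReal (r ^ a) * dualPower h a x := by
  unfold dualPower
  rw [← lintegral_const_mul' _ _ ENNReal.ofReal_ne_top]
  refine lintegral_congr fun γ => ?_
  rw [dist0_plane_smul h γ hr, Real.mul_rpow hr (dist0_nonneg _),
    ENNReal.ofReal_mul (by positivity)]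

theorem dualPower_eq (h : k ≤ n) (a : ℝ) {e : E n} (he : ‖e‖ = 1) (x : E n) :
    dualPower h a x = ENNReal.ofReal (‖x‖ ^ a) * dualPower h a e := by
  obtain ⟨δ, hδ⟩ := exists_apply_eq (x := ‖x‖ • e) (y := x) (by simp [norm_smul, he])
  rw [← dualPower_smul h a (norm_nonneg x), ← dualPower_apply h a δ (‖x‖ • e), hδ]

/-- Rotation invariance and homogeneity leave one unknown, the value at a unit vector. Pairing with
`exp (-|x|²)` and evaluating both sides of the Fubini identity determines it, and in particular
shows that it is finite. -/
theorem lintegral_dist0_rpow (h : k < n) {a : ℝ} (ha : -((n : ℝ) - k) < a) (x : E n) :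
    ∫⁻ γ, ENNReal.ofReal ((plane h.le γ x).dist0 ^ a) ∂(haarO n) =
      ENNReal.ofReal (dualConst n k a) * ENNReal.ofReal (‖x‖ ^ a) := by
  change dualPower h.le a x = _
  set e : E n := EuclideanSpace.single ⟨0, Nat.zero_lt_of_lt h⟩ 1 with he
  have he1 : ‖e‖ = 1 := by simp [he]
  rw [dualPower_eq h.le a he1, mul_comm]
  congr 1
  have hw : Measurable fun r : ℝ => ENNReal.ofReal (Real.exp (-r ^ 2)) := by fun_prop
  have key := lintegral_norm_mul_dual h.le hw (measurable_dist0_rpow a)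
  have hk : (0 : ℝ) ≤ k := by positivity
  have hnk : ((n - k : ℕ) : ℝ) = n - k := Nat.cast_sub h.le
  have hdn : Module.finrank ℝ (E n) = n := by simp
  have hdU := finrank_coordPlane_orthogonal h.le
  have h1 := sphereArea_pos (Nat.sub_pos_of_lt h)
  have h2 := sphereArea_pos (Nat.zero_lt_of_lt h)
  have h3 : 0 < Real.Gamma (((n : ℝ) - k + a) / 2) := Real.Gamma_pos_of_pos (by linarith)
  have h4 : 0 < Real.Gamma (((n : ℝ) + a) / 2) := Real.Gamma_pos_of_pos (by linarith)
  have hL : ∫⁻ x : E n, ENNReal.ofReal (Real.exp (-‖x‖ ^ 2)) *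
      ∫⁻ γ, ENNReal.ofReal ((plane h.le γ x).dist0 ^ a) ∂(haarO n) =
      ENNReal.ofReal (sphereArea n * (Real.Gamma (((n : ℝ) + a) / 2) / 2)) *
        dualPower h.le a e := by
    have := lintegral_norm_rpow_mul_gaussian (F := E n) (s := a) (by omega)
      (by rw [hdn]; linarith)
    rw [hdn] at this
    rw [← this, ← lintegral_mul_const _ (by fun_prop)]
    refine lintegral_congr fun x => ?_
    change _ * dualPower h.le a x = _
    rw [dualPower_eq h.le a he1, ← mul_assoc, ← ENNReal.ofReal_mul (Real.exp_pos _).le,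
      mul_comm (Real.exp _)]
  have hR : ∫⁻ τ : AffinePlane n k, ENNReal.ofReal (τ.dist0 ^ a) *
      (∫⁻ y : coordPlane h.le, ENNReal.ofReal (Real.exp (-Real.sqrt (τ.dist0 ^ 2 + ‖y‖ ^ 2) ^ 2)))
        ∂(planeMeasure h.le) =
      ENNReal.ofReal (sphereArea (n - k) * (Real.Gamma (((n : ℝ) - k + a) / 2) / 2)) *
        ENNReal.ofReal (Real.pi ^ ((k : ℝ) / 2)) := by
    have := lintegral_norm_rpow_mul_gaussian (F := (coordPlane h.le)ᗮ) (s := a) (by omega)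
      (by rw [hdU, hnk]; linarith)
    rw [hdU, hnk, ← lintegral_dist0_planeMeasure h.le
      (g := fun r => ENNReal.ofReal (r ^ a * Real.exp (-r ^ 2))) (by fun_prop)] at this
    rw [← this, ← lintegral_mul_const' _ _ ENNReal.ofReal_ne_top]
    refine lintegral_congr fun τ => ?_
    have hG := lintegral_gaussian (F := coordPlane h.le) one_pos
    rw [finrank_coordPlane, div_one] at hG
    rw [ENNReal.ofReal_mul (Real.rpow_nonneg (dist0_nonneg _) _), mul_assoc, ← hG]
    congr 1
    rw [← lintegral_const_mul' _ _ ENNReal.ofReal_ne_top]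
    refine lintegral_congr fun y => ?_
    rw [Real.sq_sqrt (by positivity), ← ENNReal.ofReal_mul (Real.exp_pos _).le, ← Real.exp_add]
    congr 2; ring
  rw [hL, hR] at key
  have hc : 0 < sphereArea n * (Real.Gamma (((n : ℝ) + a) / 2) / 2) := by positivity
  refine (ENNReal.mul_right_inj (ENNReal.ofReal_pos.mpr hc).ne' ENNReal.ofReal_ne_top).mp ?_
  rw [key, ← ENNReal.ofReal_mul (by positivity), ← ENNReal.ofReal_mul (by positivity), dualConst]
  congr 1
  field_simp

/-! ### The sharp upper bound. -/

/-- The norm of the dual transform, in terms of `t = 1 / p` and the weight `μ`. -/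
def dualNorm (n k : ℕ) (t μ : ℝ) : ℝ :=
  Real.pi ^ ((k : ℝ) / 2) * (sphereArea (n - k) / sphereArea n) ^ (1 - t) *
    (Real.Gamma (((n - k) * (1 - t) - μ) / 2) / Real.Gamma ((n * (1 - t) + k * t - μ) / 2))

theorem dualNorm_pos (h : k < n) {t μ : ℝ} (hμ : μ < (n - k) * (1 - t)) :
    0 < dualNorm n k t μ := by
  have h1 := sphereArea_pos (Nat.sub_pos_of_lt h)
  have h2 := sphereArea_pos (Nat.zero_lt_of_lt h)
  have h3 : 0 < Real.Gamma (((n - k : ℝ) * (1 - t) - μ) / 2) := Real.Gamma_pos_of_pos (by linarith)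
  have hk : (0 : ℝ) ≤ k := by positivity
  have h4 : 0 < Real.Gamma (((n : ℝ) * (1 - t) + k * t - μ) / 2) :=
    Real.Gamma_pos_of_pos (by nlinarith)
  unfold dualNorm
  positivity

/-- Displays the norm as the multiplier of the critical power times the area ratio that arises from
comparing norms of cut-off powers. -/
theorem dualNorm_eq (h : k < n) (t μ : ℝ) :
    dualNorm n k t μ =
      dualConst n k (-μ - (n - k) * t) * (sphereArea n / sphereArea (n - k)) ^ t := by
  have h1 := sphereArea_pos (Nat.sub_pos_of_lt h)
  have h2 := sphereArea_pos (Nat.zero_lt_of_lt h)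
  rw [dualNorm, dualConst, Real.rpow_sub (by positivity), Real.rpow_one, ← inv_div (sphereArea n),
    Real.inv_rpow (by positivity),
    show ((n : ℝ) - k + (-μ - (n - k) * t)) = (n - k) * (1 - t) - μ by ring,
    show ((n : ℝ) + (-μ - (n - k) * t)) = n * (1 - t) + k * t - μ by ring]
  have : 0 < (sphereArea n / sphereArea (n - k)) ^ t := by positivity
  field_simp

/-- Schur test with the power `|τ|^a`, carried out in `[0, ∞]` so that no integrability is needed
beforehand. -/
theorem lintegral_weighted_dual_le (h : k < n) {q t μ : ℝ} (hq : 1 ≤ q) (ht : t = q⁻¹)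
    (hμ : μ < (n - k) * (1 - t)) {g : AffinePlane n k → ℝ≥0∞} (hg : Measurable g) :
    ∫⁻ x : E n, (ENNReal.ofReal (‖x‖ ^ (μ - k * t)) * ∫⁻ γ, g (plane h.le γ x) ∂(haarO n)) ^ q ≤
      ENNReal.ofReal (dualNorm n k t μ) ^ q *
        ∫⁻ τ, (ENNReal.ofReal (τ.dist0 ^ μ) * g τ) ^ q ∂(planeMeasure h.le) := by
  have hq0 : 0 < q := by linarith
  have htq : t * q = 1 := by rw [ht]; exact inv_mul_cancel₀ hq0.ne'
  have ht0 : 0 < t := by rw [ht]; positivity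
  have ht1 : t ≤ 1 := by rw [ht]; exact inv_le_one_of_one_le₀ hq
  have h1 := sphereArea_pos (Nat.sub_pos_of_lt h)
  have h2 := sphereArea_pos (Nat.zero_lt_of_lt h)
  have hk : (0 : ℝ) ≤ k := by positivity
  have hG1 : 0 < Real.Gamma (((n - k : ℝ) * (1 - t) - μ) / 2) := Real.Gamma_pos_of_pos (by linarith)
  have hG2 : 0 < Real.Gamma (((n : ℝ) * (1 - t) + k * t - μ) / 2) :=
    Real.Gamma_pos_of_pos (by nlinarith)
  -- The critical exponent: `(μ + a) q = -(n - k)`, so `|τ|^a` has logarithmically divergent norm.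
  set a : ℝ := -μ - (n - k) * t with ha
  -- The total power of `|x|` after Hölder: the target weight, plus what the transform of `|τ|^a`
  -- contributes to the power `q - 1`.
  set b : ℝ := (μ - k * t) * q + a * (q - 1) with hb
  have haq : a * q = -μ * q - (n - k) := by rw [ha]; linear_combination (-(n - k : ℝ)) * htq
  have hbk : b + k = -((n - k) * (1 - t) - μ) := by
    rw [hb]; linear_combination haq - (k : ℝ) * htq - ha
  have ha1 : -((n : ℝ) - k) < a := by rw [ha]; nlinarith
  have hc := dualConst_pos h ha1
  -- Chosen so that `g = G^t * (|τ|^a)^(1-t)` wherever `|τ| > 0`, ready for Hölder with exponents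
  -- `t` and `1 - t`.
  set G : AffinePlane n k → ℝ≥0∞ :=
    fun τ => g τ ^ q * ENNReal.ofReal (τ.dist0 ^ (-a * (q - 1))) with hGdef
  have hG : Measurable G := (hg.pow_const q).mul (measurable_dist0_rpow _)
  set w : ℝ → ℝ≥0∞ := fun r => ENNReal.ofReal (r ^ b) with hwdef
  have hw : Measurable w := by fun_prop
  have hpt : ∀ᵐ x : E n,
      (ENNReal.ofReal (‖x‖ ^ (μ - k * t)) * ∫⁻ γ, g (plane h.le γ x) ∂(haarO n)) ^ q ≤
      ENNReal.ofReal (dualConst n k a ^ (q - 1)) *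
        (w ‖x‖ * ∫⁻ γ, G (plane h.le γ x) ∂(haarO n)) := by
    have : Nontrivial (E n) := Module.nontrivial_of_finrank_pos (R := ℝ) (by simp; omega)
    filter_upwards [ae_ae_plane h.le (ae_dist0_pos h), Measure.ae_ne volume (0 : E n)] with x hx hx0
    have hx0 : 0 < ‖x‖ := norm_pos_iff.mpr hx0
    have hf : ∫⁻ γ, g (plane h.le γ x) ∂(haarO n) =
        ∫⁻ γ, G (plane h.le γ x) ^ t *
          ENNReal.ofReal ((plane h.le γ x).dist0 ^ a) ^ (1 - t) ∂(haarO n) := by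
      refine lintegral_congr_ae ?_
      filter_upwards [hx] with γ hγ
      set D := (plane h.le γ x).dist0
      rw [hGdef]
      simp only
      rw [ENNReal.mul_rpow_of_nonneg _ _ ht0.le, ← ENNReal.rpow_mul, mul_comm q t, htq,
        ENNReal.rpow_one, mul_assoc, ENNReal.ofReal_rpow_of_nonneg (by positivity) ht0.le,
        ENNReal.ofReal_rpow_of_nonneg (by positivity) (by linarith),
        ← ENNReal.ofReal_mul (by positivity), ← Real.rpow_mul hγ.le, ← Real.rpow_mul hγ.le,
        ← Real.rpow_add hγ,
        show -a * (q - 1) * t + a * (1 - t) = 0 by linear_combination (-a) * htq,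
        Real.rpow_zero, ENNReal.ofReal_one, mul_one]
    have hH : ∫⁻ γ, g (plane h.le γ x) ∂(haarO n) ≤
        (∫⁻ γ, G (plane h.le γ x) ∂(haarO n)) ^ t *
          (ENNReal.ofReal (dualConst n k a) * ENNReal.ofReal (‖x‖ ^ a)) ^ (1 - t) := by
      rw [hf, ← lintegral_dist0_rpow h ha1 x]
      have m1 := hG.comp (measurable_plane_left h.le x)
      have m2 := (measurable_dist0_rpow (n := n) (k := k) a).comp (measurable_plane_left h.le x)
      exact ENNReal.lintegral_mul_norm_pow_le m1.aemeasurable m2.aemeasurable ht0.le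
        (by linarith) (by ring)
    calc _ ≤ (ENNReal.ofReal (‖x‖ ^ (μ - k * t)) *
          ((∫⁻ γ, G (plane h.le γ x) ∂(haarO n)) ^ t *
          (ENNReal.ofReal (dualConst n k a) * ENNReal.ofReal (‖x‖ ^ a)) ^ (1 - t))) ^ q := by
          gcongr
      _ = _ := by
          rw [ENNReal.mul_rpow_of_nonneg _ _ hq0.le, ENNReal.mul_rpow_of_nonneg _ _ hq0.le,
            ← ENNReal.rpow_mul, htq, ENNReal.rpow_one, ← ENNReal.rpow_mul,
            show (1 - t) * q = q - 1 by linear_combination -htq,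
            ← ENNReal.ofReal_mul hc.le, ENNReal.ofReal_rpow_of_nonneg (by positivity) hq0.le,
            ENNReal.ofReal_rpow_of_nonneg (by positivity) (by linarith),
            Real.mul_rpow hc.le (by positivity), ENNReal.ofReal_mul (by positivity),
            ← Real.rpow_mul hx0.le, ← Real.rpow_mul hx0.le]
          rw [hwdef, hb]
          simp only
          rw [Real.rpow_add hx0, ENNReal.ofReal_mul (by positivity)]
          ring
  refine (lintegral_mono_ae hpt).trans ?_
  rw [lintegral_const_mul' _ _ ENNReal.ofReal_ne_top, lintegral_norm_mul_dual h.le hw hG,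
    ← lintegral_const_mul' _ _ ENNReal.ofReal_ne_top,
    ← lintegral_const_mul' _ _ (ENNReal.rpow_ne_top_of_nonneg hq0.le ENNReal.ofReal_ne_top)]
  refine lintegral_mono_ae ?_
  filter_upwards [ae_dist0_pos h] with τ hτ
  set D := τ.dist0
  -- Convergence requires `b + k < 0`, which by `hbk` is exactly the hypothesis on `μ`.
  have hy := lintegral_rpow_add_norm_sq (F := coordPlane h.le) (b := b) hτ
    (by rw [finrank_coordPlane]; nlinarith)
  rw [finrank_coordPlane] at hy
  have hS : 0 < sphereArea (n - k) / sphereArea n := by positivity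
  have hκ : 0 < Real.pi ^ ((k : ℝ) / 2) * (Real.Gamma (((n - k : ℝ) * (1 - t) - μ) / 2) /
      Real.Gamma (((n : ℝ) * (1 - t) + k * t - μ) / 2)) := by positivity
  rw [hwdef, hGdef]
  simp only
  rw [hy, show -(b + k) / 2 = ((n - k : ℝ) * (1 - t) - μ) / 2 by rw [hbk]; ring,
    show -b / 2 = ((n : ℝ) * (1 - t) + k * t - μ) / 2 by linear_combination (-1 / 2) * hbk,
    dualConst, dualNorm,
    show ((n : ℝ) - k + a) = (n - k) * (1 - t) - μ by rw [ha]; ring,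
    show ((n : ℝ) + a) = n * (1 - t) + k * t - μ by rw [ha]; ring]
  -- The Gamma quotient of this integral is the one in `dualConst`; call it `κ`, with its power of
  -- `π`. The constants then combine as `(κ S)^(q-1) κ = (κ S^(1-t))^q`.
  set S := sphereArea (n - k) / sphereArea n
  set κ := Real.pi ^ ((k : ℝ) / 2) * (Real.Gamma (((n - k : ℝ) * (1 - t) - μ) / 2) /
      Real.Gamma (((n : ℝ) * (1 - t) + k * t - μ) / 2)) with hκdef
  have e1 : Real.pi ^ ((k : ℝ) / 2) * S * (Real.Gamma (((n - k : ℝ) * (1 - t) - μ) / 2) /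
      Real.Gamma (((n : ℝ) * (1 - t) + k * t - μ) / 2)) = κ * S := by rw [hκdef]; ring
  have e2 : Real.pi ^ ((k : ℝ) / 2) * S ^ (1 - t) *
      (Real.Gamma (((n - k : ℝ) * (1 - t) - μ) / 2) /
      Real.Gamma (((n : ℝ) * (1 - t) + k * t - μ) / 2)) = κ * S ^ (1 - t) := by rw [hκdef]; ring
  rw [e1, e2, ENNReal.mul_rpow_of_nonneg _ _ hq0.le,
    ENNReal.ofReal_rpow_of_nonneg (by positivity) hq0.le,
    ENNReal.ofReal_rpow_of_nonneg (by positivity) hq0.le, Real.mul_rpow hκ.le (by positivity),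
    Real.mul_rpow hκ.le (by positivity : 0 ≤ S ^ (1 - t)), ← Real.rpow_mul hS.le, ← Real.rpow_mul hτ.le,
    show (1 - t) * q = q - 1 by linear_combination -htq]
  have e3 : ENNReal.ofReal (κ ^ (q - 1) * S ^ (q - 1)) * (g τ ^ q *
      ENNReal.ofReal (D ^ (-a * (q - 1))) * ENNReal.ofReal (κ * D ^ (b + k))) =
      ENNReal.ofReal (κ ^ (q - 1) * S ^ (q - 1) * (D ^ (-a * (q - 1)) * (κ * D ^ (b + k)))) *
        g τ ^ q := by
    rw [ENNReal.ofReal_mul (by positivity : 0 ≤ κ ^ (q - 1) * S ^ (q - 1)),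
      ENNReal.ofReal_mul (by positivity : 0 ≤ D ^ (-a * (q - 1)))]
    ring
  rw [e3, ← mul_assoc (ENNReal.ofReal _) (ENNReal.ofReal _),
    ← ENNReal.ofReal_mul (by positivity)]
  refine le_of_eq ?_
  congr 2
  rw [show μ * q = -a * (q - 1) + (b + k) by rw [hb]; linear_combination (k : ℝ) * htq,
    Real.rpow_add hτ (-a * (q - 1)), Real.rpow_sub hκ, Real.rpow_one]
  field_simp

/-- The case `t = 0`: `g` is dominated by `M |τ|^(-μ)`, whose transform is explicit. -/
theorem weighted_dual_le_of_ae_le (h : k < n) {μ : ℝ} (hμ : μ < n - k)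
    {g : AffinePlane n k → ℝ≥0∞} {M : ℝ≥0∞}
    (hM : ∀ᵐ τ ∂(planeMeasure h.le), ENNReal.ofReal (τ.dist0 ^ μ) * g τ ≤ M) :
    ∀ᵐ x : E n, ENNReal.ofReal (‖x‖ ^ μ) * ∫⁻ γ, g (plane h.le γ x) ∂(haarO n) ≤
      ENNReal.ofReal (dualNorm n k 0 μ) * M := by
  have : Nontrivial (E n) := Module.nontrivial_of_finrank_pos (R := ℝ) (by simp; omega)
  filter_upwards [ae_ae_plane h.le (ae_dist0_pos h), ae_ae_plane h.le hM,
    Measure.ae_ne volume (0 : E n)] with x hx hxM hx0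
  have hx0 : 0 < ‖x‖ := norm_pos_iff.mpr hx0
  have hle : ∫⁻ γ, g (plane h.le γ x) ∂(haarO n) ≤
      ∫⁻ γ, ENNReal.ofReal ((plane h.le γ x).dist0 ^ (-μ)) * M ∂(haarO n) := by
    refine lintegral_mono_ae ?_
    filter_upwards [hx, hxM] with γ hγ hγM
    refine le_trans (le_of_eq ?_) (mul_le_mul_right hγM _)
    rw [← mul_assoc, ← ENNReal.ofReal_mul (by positivity), ← Real.rpow_add hγ, neg_add_cancel,
      Real.rpow_zero, ENNReal.ofReal_one, one_mul]
  have m2 := (measurable_dist0_rpow (n := n) (k := k) (-μ)).comp (measurable_plane_left h.le x)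
  have hI : ∫⁻ γ, ENNReal.ofReal ((plane h.le γ x).dist0 ^ (-μ)) * M ∂(haarO n) =
      (∫⁻ γ, ENNReal.ofReal ((plane h.le γ x).dist0 ^ (-μ)) ∂(haarO n)) * M :=
    lintegral_mul_const M m2
  rw [hI, lintegral_dist0_rpow h (by linarith) x] at hle
  refine (mul_le_mul_right hle _).trans (le_of_eq ?_)
  rw [dualNorm_eq h, Real.rpow_zero, mul_one, mul_zero, sub_zero, ← mul_assoc,
    mul_left_comm, ← ENNReal.ofReal_mul (by positivity), ← Real.rpow_add hx0, add_neg_cancel,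
    Real.rpow_zero, ENNReal.ofReal_one, mul_one]

theorem ae_lt_top_of_eLpNorm_lt_top {α : Type*} [MeasurableSpace α] {m : Measure α} {p : ℝ≥0∞}
    (hp : p ≠ 0) {f : α → ℝ≥0∞} (hf : AEMeasurable f m) (h : eLpNorm f p m < ∞) :
    ∀ᵐ x ∂m, f x < ∞ := by
  rcases eq_or_ne p ∞ with rfl | hp'
  · filter_upwards [enorm_ae_le_eLpNormEssSup f m] with x hx
    rw [eLpNorm_exponent_top] at h
    exact lt_of_le_of_lt (by simpa using hx) h
  · have h0 := lintegral_rpow_enorm_lt_top_of_eLpNorm_lt_top hp hp' h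
    have hq : 0 < p.toReal := ENNReal.toReal_pos hp hp'
    simp only [enorm_eq_self] at h0
    filter_upwards [ae_lt_top' (hf.pow_const _) h0.ne] with x hx
    exact (ENNReal.rpow_lt_top_iff_of_pos hq).mp hx

theorem eLpNorm_weighted_dual_le (h : k < n) {p : ℝ≥0∞} (hp : 1 ≤ p) {μ : ℝ}
    (hμ : μ < (n - k) * (1 - (p⁻¹).toReal)) {g : AffinePlane n k → ℝ≥0∞} (hg : Measurable g) :
    eLpNorm (fun x : E n => ENNReal.ofReal (‖x‖ ^ (μ - k * (p⁻¹).toReal)) *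
        ∫⁻ γ, g (plane h.le γ x) ∂(haarO n)) p volume ≤
      ENNReal.ofReal (dualNorm n k (p⁻¹).toReal μ) *
        eLpNorm (fun τ => ENNReal.ofReal (τ.dist0 ^ μ) * g τ) p (planeMeasure h.le) := by
  have hp0 : p ≠ 0 := (zero_lt_one.trans_le hp).ne'
  rcases eq_or_ne p ∞ with rfl | hp'
  · simp only [ENNReal.inv_top, ENNReal.toReal_zero, sub_zero, mul_one, mul_zero] at hμ ⊢
    rw [eLpNorm_exponent_top, eLpNorm_exponent_top]
    refine eLpNormEssSup_le_of_ae_enorm_bound ?_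
    refine weighted_dual_le_of_ae_le h hμ ?_
    filter_upwards [enorm_ae_le_eLpNormEssSup
      (fun τ : AffinePlane n k => ENNReal.ofReal (τ.dist0 ^ μ) * g τ) (planeMeasure h.le)]
      with τ hτ
    simpa using hτ
  · have hq : 1 ≤ p.toReal := by
      rw [← ENNReal.toReal_one]
      exact ENNReal.toReal_mono hp' hp
    have hq0 : 0 < p.toReal := by linarith
    have key := lintegral_weighted_dual_le h hq (ENNReal.toReal_inv p) hμ hg
    rw [eLpNorm_eq_lintegral_rpow_enorm_toReal hp0 hp',
      eLpNorm_eq_lintegral_rpow_enorm_toReal hp0 hp']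
    simp only [enorm_eq_self]
    refine (ENNReal.rpow_le_rpow key (by positivity)).trans (le_of_eq ?_)
    rw [ENNReal.mul_rpow_of_nonneg _ _ (by positivity), ← ENNReal.rpow_mul,
      mul_one_div_cancel hq0.ne', ENNReal.rpow_one]

/-! ### The bounded operator on classes. -/

section Operator

variable {𝕜 : Type*} [RCLike 𝕜]

theorem enorm_rpow_smul {r : ℝ} (hr : 0 ≤ r) (s : ℝ) (z : 𝕜) :
    ‖r ^ s • z‖ₑ = ENNReal.ofReal (r ^ s) * ‖z‖ₑ := by
  rw [enorm_smul, Real.enorm_of_nonneg (Real.rpow_nonneg hr s)]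

theorem stronglyMeasurable_comp_plane_left (h : k ≤ n) {φ : AffinePlane n k → 𝕜}
    (hφ : StronglyMeasurable φ) (x : E n) : StronglyMeasurable fun γ : O n => φ (plane h γ x) :=
  hφ.comp_measurable (measurable_plane_left h x)

theorem stronglyMeasurable_dualTransform (h : k ≤ n) {φ : AffinePlane n k → 𝕜}
    (hφ : StronglyMeasurable φ) : StronglyMeasurable (dualTransform h φ) := by
  have h1 := hφ.comp_measurable (measurable_plane_swap h)
  exact StronglyMeasurable.integral_prod_right' (ν := haarO n) h1

theorem eLpNorm_dualTransform_le (h : k < n) {p : ℝ≥0∞} (hp : 1 ≤ p) {μ : ℝ}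
    (hμ : μ < (n - k) * (1 - (p⁻¹).toReal)) {φ : AffinePlane n k → 𝕜}
    (hφ : StronglyMeasurable φ) :
    eLpNorm (fun x : E n => ‖x‖ ^ (μ - k * (p⁻¹).toReal) • dualTransform h.le φ x) p volume ≤
      ENNReal.ofReal (dualNorm n k (p⁻¹).toReal μ) *
        eLpNorm (fun τ => τ.dist0 ^ μ • φ τ) p (planeMeasure h.le) := by
  have key := eLpNorm_weighted_dual_le h hp hμ (g := fun τ => ‖φ τ‖ₑ) hφ.measurable.enorm
  have e : eLpNorm (fun τ => ENNReal.ofReal (τ.dist0 ^ μ) * ‖φ τ‖ₑ) p (planeMeasure h.le) =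
      eLpNorm (fun τ => τ.dist0 ^ μ • φ τ) p (planeMeasure h.le) :=
    eLpNorm_congr_enorm_ae (Filter.Eventually.of_forall fun τ => by
      rw [enorm_rpow_smul (dist0_nonneg τ), enorm_eq_self])
  rw [e] at key
  refine le_trans (eLpNorm_mono_enorm_ae (Filter.Eventually.of_forall fun x => ?_)) key
  rw [enorm_rpow_smul (norm_nonneg x), enorm_eq_self]
  exact mul_le_mul_right (enorm_integral_le_lintegral_enorm _) _

/-- The norm estimate for `‖φ‖ₑ` makes its weighted transform finite almost everywhere, and the
weight is nonzero for `x ≠ 0`. -/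
theorem ae_integrable_comp_plane (h : k < n) {p : ℝ≥0∞} (hp : 1 ≤ p) {μ : ℝ}
    (hμ : μ < (n - k) * (1 - (p⁻¹).toReal)) {φ : AffinePlane n k → 𝕜}
    (hφ : StronglyMeasurable φ)
    (hL : MemLp (fun τ => τ.dist0 ^ μ • φ τ) p (planeMeasure h.le)) :
    ∀ᵐ x : E n, Integrable (fun γ => φ (plane h.le γ x)) (haarO n) := by
  have : Nontrivial (E n) := Module.nontrivial_of_finrank_pos (R := ℝ) (by simp; omega)
  have key := eLpNorm_weighted_dual_le h hp hμ (g := fun τ => ‖φ τ‖ₑ) hφ.measurable.enorm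
  have e : eLpNorm (fun τ => ENNReal.ofReal (τ.dist0 ^ μ) * ‖φ τ‖ₑ) p (planeMeasure h.le) =
      eLpNorm (fun τ => τ.dist0 ^ μ • φ τ) p (planeMeasure h.le) :=
    eLpNorm_congr_enorm_ae (Filter.Eventually.of_forall fun τ => by
      rw [enorm_rpow_smul (dist0_nonneg τ), enorm_eq_self])
  rw [e] at key
  have hfin := key.trans_lt (ENNReal.mul_lt_top ENNReal.ofReal_lt_top hL.2)
  have hm : Measurable fun x : E n => ∫⁻ γ, ‖φ (plane h.le γ x)‖ₑ ∂(haarO n) := by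
    have h1 := hφ.measurable.enorm.comp (measurable_plane_swap h.le)
    exact h1.lintegral_prod_right'
  have hm' : Measurable fun x : E n => ENNReal.ofReal (‖x‖ ^ (μ - k * (p⁻¹).toReal)) *
      ∫⁻ γ, ‖φ (plane h.le γ x)‖ₑ ∂(haarO n) :=
    (measurable_norm.pow_const _).ennreal_ofReal.mul hm
  filter_upwards [ae_lt_top_of_eLpNorm_lt_top (zero_lt_one.trans_le hp).ne' hm'.aemeasurable hfin,
    Measure.ae_ne volume (0 : E n)] with x hx hx0
  have hx0 : 0 < ‖x‖ := norm_pos_iff.mpr hx0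
  refine ⟨(stronglyMeasurable_comp_plane_left h.le hφ x).aestronglyMeasurable, ?_⟩
  refine ENNReal.lt_top_of_mul_ne_top_right hx.ne ?_
  exact (ENNReal.ofReal_pos.mpr (by positivity)).ne'

theorem dualTransform_congr (h : k ≤ n) {φ ψ : AffinePlane n k → 𝕜}
    (hφψ : φ =ᵐ[planeMeasure h] ψ) : dualTransform h φ =ᵐ[volume] dualTransform h ψ := by
  filter_upwards [ae_ae_plane h hφψ] with x hx
  exact integral_congr_ae hx

variable (𝕜) in
/-- The dual `k`-plane transform as a linear map from `L^p_μ` to `L^p_ν`. -/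
def dualLinearMap (h : k < n) (p : ℝ≥0∞) [hp : Fact (1 ≤ p)] {μ : ℝ}
    (hμ : μ < (n - k) * (1 - (p⁻¹).toReal)) :
    PlaneLp 𝕜 h.le p μ →ₗ[𝕜] SpaceLp 𝕜 n p (μ - k * (p⁻¹).toReal) where
  toFun := fun F => ⟨AEEqFun.mk (dualTransform h.le F.1)
    (stronglyMeasurable_dualTransform h.le F.1.stronglyMeasurable).aestronglyMeasurable, by
      have hm := stronglyMeasurable_dualTransform h.le F.1.stronglyMeasurable
      have hb := eLpNorm_dualTransform_le h hp.out hμ F.1.stronglyMeasurable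
      refine (memLp_congr_ae ?_).mpr (⟨?_, hb.trans_lt
        (ENNReal.mul_lt_top ENNReal.ofReal_lt_top (MemLp.eLpNorm_lt_top F.2))⟩ :
        MemLp (fun x : E n => ‖x‖ ^ (μ - k * (p⁻¹).toReal) • dualTransform h.le F.1 x) p volume)
      · filter_upwards [AEEqFun.coeFn_mk (dualTransform h.le F.1) hm.aestronglyMeasurable]
          with x hx
        rw [hx]
      · exact ((measurable_norm.pow_const _).stronglyMeasurable.smul hm).aestronglyMeasurable⟩
  map_add' := fun F G => by
    refine Subtype.ext ?_
    refine AEEqFun.ext ?_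
    have hF := stronglyMeasurable_dualTransform h.le F.1.stronglyMeasurable
    have hG := stronglyMeasurable_dualTransform h.le G.1.stronglyMeasurable
    have hFG := stronglyMeasurable_dualTransform h.le (F + G).1.stronglyMeasurable
    refine (AEEqFun.coeFn_mk _ hFG.aestronglyMeasurable).trans ?_
    refine Filter.EventuallyEq.trans ?_ (AEEqFun.coeFn_add _ _).symm
    filter_upwards [AEEqFun.coeFn_mk _ hF.aestronglyMeasurable,
      AEEqFun.coeFn_mk _ hG.aestronglyMeasurable,
      ae_ae_plane h.le (AEEqFun.coeFn_add F.1 G.1),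
      ae_integrable_comp_plane h hp.out hμ F.1.stronglyMeasurable F.2,
      ae_integrable_comp_plane h hp.out hμ G.1.stronglyMeasurable G.2]
      with x h1 h2 h3 h4 h5
    simp only [Pi.add_apply]
    rw [h1, h2]
    exact (integral_congr_ae h3).trans (integral_add h4 h5)
  map_smul' := fun c F => by
    refine Subtype.ext ?_
    refine AEEqFun.ext ?_
    have hF := stronglyMeasurable_dualTransform h.le F.1.stronglyMeasurable
    have hcF := stronglyMeasurable_dualTransform h.le (c • F).1.stronglyMeasurable
    refine (AEEqFun.coeFn_mk _ hcF.aestronglyMeasurable).trans ?_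
    refine Filter.EventuallyEq.trans ?_ (AEEqFun.coeFn_smul _ _).symm
    filter_upwards [AEEqFun.coeFn_mk _ hF.aestronglyMeasurable,
      ae_ae_plane h.le (AEEqFun.coeFn_smul c F.1)] with x h1 h3
    simp only [Pi.smul_apply, RingHom.id_apply]
    rw [h1]
    -- Unlike additivity, this needs no integrability.
    exact (integral_congr_ae h3).trans (integral_smul c _)

theorem coeFn_dualLinearMap (h : k < n) (p : ℝ≥0∞) [Fact (1 ≤ p)] {μ : ℝ}
    (hμ : μ < (n - k) * (1 - (p⁻¹).toReal)) (F : PlaneLp 𝕜 h.le p μ) :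
    (dualLinearMap 𝕜 h p hμ F).1 =ᵐ[volume] dualTransform h.le F.1 :=
  AEEqFun.coeFn_mk _
    (stronglyMeasurable_dualTransform h.le F.1.stronglyMeasurable).aestronglyMeasurable

theorem norm_dualLinearMap_le (h : k < n) (p : ℝ≥0∞) [hp : Fact (1 ≤ p)] {μ : ℝ}
    (hμ : μ < (n - k) * (1 - (p⁻¹).toReal)) (F : PlaneLp 𝕜 h.le p μ) :
    ‖dualLinearMap 𝕜 h p hμ F‖ ≤ dualNorm n k (p⁻¹).toReal μ * ‖F‖ := by
  have hb := eLpNorm_dualTransform_le h hp.out hμ F.1.stronglyMeasurable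
  have e : eLpNorm (fun x : E n => ‖x‖ ^ (μ - k * (p⁻¹).toReal) •
      (dualLinearMap 𝕜 h p hμ F).1 x) p volume =
      eLpNorm (fun x : E n => ‖x‖ ^ (μ - k * (p⁻¹).toReal) • dualTransform h.le F.1 x) p volume := by
    refine eLpNorm_congr_ae ?_
    filter_upwards [coeFn_dualLinearMap h p hμ F] with x hx
    rw [hx]
  rw [WeightedLp.norm_def, WeightedLp.norm_def,
    ← ENNReal.toReal_ofReal (dualNorm_pos h hμ).le, ← ENNReal.toReal_mul, e]
  exact ENNReal.toReal_mono (ENNReal.mul_ne_top ENNReal.ofReal_ne_top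
    (MemLp.eLpNorm_lt_top F.2).ne) hb

variable (𝕜) in
/-- The dual `k`-plane transform as a bounded operator from `L^p_μ` to `L^p_ν`. -/
def dualOperator (h : k < n) (p : ℝ≥0∞) [hp : Fact (1 ≤ p)] {μ : ℝ}
    (hμ : μ < (n - k) * (1 - (p⁻¹).toReal)) :
    PlaneLp 𝕜 h.le p μ →L[𝕜] SpaceLp 𝕜 n p (μ - k * (p⁻¹).toReal) :=
  LinearMap.mkContinuous (dualLinearMap 𝕜 h p hμ) (dualNorm n k (p⁻¹).toReal μ)
    (norm_dualLinearMap_le h p hμ)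

theorem norm_dualOperator_le (h : k < n) (p : ℝ≥0∞) [hp : Fact (1 ≤ p)] {μ : ℝ}
    (hμ : μ < (n - k) * (1 - (p⁻¹).toReal)) :
    ‖dualOperator 𝕜 h p hμ‖ ≤ dualNorm n k (p⁻¹).toReal μ :=
  LinearMap.mkContinuous_norm_le _ (dualNorm_pos h hμ).le _

theorem coeFn_dualOperator (h : k < n) (p : ℝ≥0∞) [hp : Fact (1 ≤ p)] {μ : ℝ}
    (hμ : μ < (n - k) * (1 - (p⁻¹).toReal)) (F : PlaneLp 𝕜 h.le p μ) :
    (dualOperator 𝕜 h p hμ F).1 =ᵐ[volume] dualTransform h.le F.1 :=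
  coeFn_dualLinearMap h p hμ F

/-- Holds for every representative: for almost every `x`, changing `φ` on a null set of planes
affects only a null set of `γ`. -/
theorem dualOperator_spec (h : k < n) (p : ℝ≥0∞) [hp : Fact (1 ≤ p)] {μ : ℝ}
    (hμ : μ < (n - k) * (1 - (p⁻¹).toReal)) (F : PlaneLp 𝕜 h.le p μ) {φ : AffinePlane n k → 𝕜}
    (hφ : φ =ᵐ[planeMeasure h.le] F.1) :
    ∀ᵐ x : E n, Integrable (fun γ => φ (plane h.le γ x)) (haarO n) ∧
      (dualOperator 𝕜 h p hμ F).1 x = dualTransform h.le φ x := by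
  filter_upwards [coeFn_dualOperator h p hμ F, dualTransform_congr h.le hφ,
    ae_integrable_comp_plane h hp.out hμ F.1.stronglyMeasurable F.2, ae_ae_plane h.le hφ]
    with x h1 h2 h3 h4
  have h4 : (fun γ => φ (plane h.le γ x)) =ᵐ[haarO n] fun γ => F.1 (plane h.le γ x) := h4
  exact ⟨h3.congr h4.symm, h1.trans h2.symm⟩

end Operator

/-! ### Sharpness by cut-off powers. -/

section LowerBound

variable (𝕜 : Type*) [RCLike 𝕜]

/-- The function `|τ|^s` cut off to the planes that meet the open unit ball. -/
def cutPower (n k : ℕ) (s : ℝ) (τ : AffinePlane n k) : 𝕜 :=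
  ((if τ.dist0 < 1 then τ.dist0 ^ s else 0 : ℝ) : 𝕜)

theorem stronglyMeasurable_cutPower (s : ℝ) : StronglyMeasurable (cutPower 𝕜 n k s) := by
  refine Measurable.stronglyMeasurable ?_
  refine RCLike.measurable_ofReal.comp ?_
  exact Measurable.ite (measurableSet_lt measurable_dist0 measurable_const)
    (measurable_dist0.pow_const s) measurable_const

theorem enorm_smul_cutPower {τ : AffinePlane n k} (hτ : 0 < τ.dist0) (r s : ℝ) :
    ‖τ.dist0 ^ r • cutPower 𝕜 n k s τ‖ₑ =
      ENNReal.ofReal (if τ.dist0 < 1 then τ.dist0 ^ (r + s) else 0) := by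
  rw [enorm_rpow_smul hτ.le, cutPower, ← ofReal_norm, RCLike.norm_ofReal,
    ← ENNReal.ofReal_mul (by positivity)]
  congr 1
  split_ifs
  · rw [abs_of_nonneg (by positivity), Real.rpow_add hτ]
  · simp

/-- The cut-off is invisible from inside the unit ball, because `|τ| ≤ |x| < 1` for every plane
through `x`. -/
theorem dualTransform_cutPower (h : k < n) {s : ℝ} (hs : -((n : ℝ) - k) < s) {x : E n}
    (hx : ‖x‖ < 1) :
    dualTransform h.le (cutPower 𝕜 n k s) x = ((dualConst n k s * ‖x‖ ^ s : ℝ) : 𝕜) := by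
  have e : ∀ γ : O n, cutPower 𝕜 n k s (plane h.le γ x) =
      (((plane h.le γ x).dist0 ^ s : ℝ) : 𝕜) := fun γ => by
    rw [cutPower, if_pos ((dist0_plane_le h.le γ x).trans_lt hx)]
  have hc := dualConst_pos h hs
  have m := (measurable_dist0.pow_const s).comp (measurable_plane_left (k := k) h.le x)
  rw [dualTransform]
  simp_rw [e]
  rw [integral_ofReal, integral_eq_lintegral_of_nonneg_ae, lintegral_dist0_rpow h hs,
    ← ENNReal.ofReal_mul hc.le, ENNReal.toReal_ofReal (by positivity)]
  · exact Filter.Eventually.of_forall fun γ => Real.rpow_nonneg (dist0_nonneg _) _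
  · exact m.aestronglyMeasurable

variable {𝕜}

theorem eLpNorm_dualTransform_le_opNorm (h : k < n) (p : ℝ≥0∞) [Fact (1 ≤ p)] {μ : ℝ}
    (hμ : μ < (n - k) * (1 - (p⁻¹).toReal)) {φ : AffinePlane n k → 𝕜}
    (hφ : StronglyMeasurable φ)
    (hL : eLpNorm (fun τ => τ.dist0 ^ μ • φ τ) p (planeMeasure h.le) < ∞) :
    eLpNorm (fun x : E n => ‖x‖ ^ (μ - k * (p⁻¹).toReal) • dualTransform h.le φ x) p volume ≤
      ENNReal.ofReal ‖dualOperator 𝕜 h p hμ‖ *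
        eLpNorm (fun τ => τ.dist0 ^ μ • φ τ) p (planeMeasure h.le) := by
  have hmk := AEEqFun.coeFn_mk φ (hφ.aestronglyMeasurable (μ := planeMeasure h.le))
  have hw : (fun τ => τ.dist0 ^ μ • AEEqFun.mk φ (hφ.aestronglyMeasurable
      (μ := planeMeasure h.le)) τ) =ᵐ[planeMeasure h.le] fun τ => τ.dist0 ^ μ • φ τ := by
    filter_upwards [hmk] with τ hτ
    rw [hτ]
  have hmem : MemLp (fun τ => τ.dist0 ^ μ • φ τ) p (planeMeasure h.le) :=
    ⟨((measurable_dist0.pow_const μ).stronglyMeasurable.smul hφ).aestronglyMeasurable, hL⟩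
  let F : PlaneLp 𝕜 h.le p μ := ⟨AEEqFun.mk φ hφ.aestronglyMeasurable, (memLp_congr_ae hw).mpr hmem⟩
  have hb := (dualOperator 𝕜 h p hμ).le_opNorm F
  rw [WeightedLp.norm_def, WeightedLp.norm_def] at hb
  have e1 : eLpNorm (fun τ => τ.dist0 ^ μ • F.1 τ) p (planeMeasure h.le) =
      eLpNorm (fun τ => τ.dist0 ^ μ • φ τ) p (planeMeasure h.le) := eLpNorm_congr_ae hw
  have e2 : eLpNorm (fun x : E n => ‖x‖ ^ (μ - k * (p⁻¹).toReal) •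
      (dualOperator 𝕜 h p hμ F).1 x) p volume =
      eLpNorm (fun x : E n => ‖x‖ ^ (μ - k * (p⁻¹).toReal) • dualTransform h.le φ x) p volume := by
    refine eLpNorm_congr_ae ?_
    filter_upwards [coeFn_dualOperator h p hμ F, dualTransform_congr h.le hmk] with x h1 h2
    rw [h1]
    exact congrArg _ h2
  have hfin := (MemLp.eLpNorm_lt_top (dualOperator 𝕜 h p hμ F).2).ne
  rw [← ENNReal.toReal_ofReal (norm_nonneg (dualOperator 𝕜 h p hμ)), ← ENNReal.toReal_mul,
    ENNReal.toReal_le_toReal hfin (ENNReal.mul_ne_top ENNReal.ofReal_ne_top (e1 ▸ hL.ne)), e1] at hb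
  exact e2 ▸ hb

/-- Here the critical power `|τ|^(-μ)` itself lies in the space, with weighted norm at most 1, so no
`ε` is needed. -/
theorem le_norm_dualOperator_top (h : k < n) {μ : ℝ} [Fact ((1 : ℝ≥0∞) ≤ ∞)]
    (hμ : μ < (n - k) * (1 - ((∞ : ℝ≥0∞)⁻¹).toReal)) :
    dualNorm n k ((∞ : ℝ≥0∞)⁻¹).toReal μ ≤ ‖dualOperator 𝕜 h ∞ hμ‖ := by
  have hμ' : μ < n - k := by simpa using hμ
  have hs : -((n : ℝ) - k) < -μ := by linarith
  have hc := dualConst_pos h hs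
  have : Nontrivial (E n) := Module.nontrivial_of_finrank_pos (R := ℝ) (by simp; omega)
  have hle : eLpNorm (fun τ => τ.dist0 ^ μ • cutPower 𝕜 n k (-μ) τ) ∞ (planeMeasure h.le) ≤ 1 := by
    rw [eLpNorm_exponent_top]
    refine eLpNormEssSup_le_of_ae_enorm_bound ?_
    filter_upwards [ae_dist0_pos h] with τ hτ
    rw [enorm_smul_cutPower 𝕜 hτ, add_neg_cancel, Real.rpow_zero]
    split_ifs <;> simp
  have hb := (eLpNorm_dualTransform_le_opNorm h ∞ hμ (stronglyMeasurable_cutPower 𝕜 (-μ))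
    (hle.trans_lt ENNReal.one_lt_top)).trans (mul_le_mul_right hle _)
  -- On the unit ball the weight cancels `|x|^(-μ)` and leaves the constant multiplier.
  have hlow : eLpNorm ((Metric.ball (0 : E n) 1).indicator fun _ => dualConst n k (-μ)) ∞ volume ≤
      eLpNorm (fun x : E n => ‖x‖ ^ (μ - k * ((∞ : ℝ≥0∞)⁻¹).toReal) •
        dualTransform h.le (cutPower 𝕜 n k (-μ)) x) ∞ volume := by
    refine eLpNorm_mono_enorm_ae ?_
    filter_upwards [Measure.ae_ne volume (0 : E n)] with x hx0
    have hx0 : 0 < ‖x‖ := norm_pos_iff.mpr hx0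
    by_cases hx : ‖x‖ < 1
    · rw [Set.indicator_of_mem (by simpa using hx), dualTransform_cutPower 𝕜 h hs hx,
        enorm_rpow_smul hx0.le, ← ofReal_norm (RCLike.ofReal _), RCLike.norm_ofReal,
        abs_of_nonneg (by positivity), ← ENNReal.ofReal_mul (by positivity),
        Real.enorm_of_nonneg hc.le]
      refine le_of_eq ?_
      congr 1
      rw [ENNReal.inv_top, ENNReal.toReal_zero, mul_zero, sub_zero, mul_left_comm,
        ← Real.rpow_add hx0, add_neg_cancel, Real.rpow_zero, mul_one]
    · rw [Set.indicator_of_notMem (by simpa using hx)]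
      simp
  rw [eLpNorm_exponent_top, eLpNormEssSup_indicator_const_eq _ _
    (Metric.measure_ball_pos volume _ one_pos).ne', Real.enorm_of_nonneg hc.le] at hlow
  have := hlow.trans hb
  rw [mul_one, ENNReal.ofReal_le_ofReal_iff (norm_nonneg _)] at this
  rw [dualNorm_eq h]
  simpa using this

/-- Test on `|τ|^s`, `s` being the critical exponent raised by `ε`. The powers `q` of the two norms
carry the same factor `1/(ε q)`, which cancels in the quotient and leaves the area ratio. -/
theorem dualConst_mul_le_norm_dualOperator (h : k < n) {p : ℝ≥0∞} [hp : Fact (1 ≤ p)] (hp' : p ≠ ∞)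
    {μ : ℝ} (hμ : μ < (n - k) * (1 - (p⁻¹).toReal)) {ε : ℝ} (hε : 0 < ε) :
    dualConst n k (-μ - (n - k) * (p⁻¹).toReal + ε) *
      (sphereArea n / sphereArea (n - k)) ^ (p⁻¹).toReal ≤ ‖dualOperator 𝕜 h p hμ‖ := by
  have hp0 : p ≠ 0 := (zero_lt_one.trans_le hp.out).ne'
  have hq : 0 < p.toReal := ENNReal.toReal_pos hp0 hp'
  set q := p.toReal with hqdef
  set t := (p⁻¹).toReal with ht
  have htq : t * q = 1 := by
    rw [ht, ENNReal.toReal_inv]; exact inv_mul_cancel₀ hq.ne'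
  have hqt : 1 / q = t := by field_simp; linarith
  have ht0 : 0 ≤ t := ENNReal.toReal_nonneg
  set s : ℝ := -μ - (n - k) * t + ε with hsdef
  have hs : -((n : ℝ) - k) < s := by rw [hsdef]; linarith
  have hc := dualConst_pos h hs
  have h1 := sphereArea_pos (Nat.sub_pos_of_lt h)
  have h2 := sphereArea_pos (Nat.zero_lt_of_lt h)
  have hεq : 0 < ε * q := by positivity
  have hnk : ((n - k : ℕ) : ℝ) = n - k := Nat.cast_sub h.le
  have hdU := finrank_coordPlane_orthogonal h.le
  have hdn : Module.finrank ℝ (E n) = n := by simp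
  have : Nontrivial (E n) := Module.nontrivial_of_finrank_pos (R := ℝ) (by simp; omega)
  have hdom : eLpNorm (fun τ => τ.dist0 ^ μ • cutPower 𝕜 n k s τ) p (planeMeasure h.le) =
      ENNReal.ofReal ((sphereArea (n - k) / (ε * q)) ^ t) := by
    have hU := lintegral_norm_rpow_unitBall (F := (coordPlane h.le)ᗮ) (by omega) hεq
    rw [hdU, hnk, ← lintegral_dist0_planeMeasure h.le
      (g := fun r => ENNReal.ofReal (if r < 1 then r ^ (ε * q - (n - k)) else 0))
      (Measurable.ennreal_ofReal (Measurable.ite measurableSet_Iio (by fun_prop) (by fun_prop)))]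
      at hU
    rw [eLpNorm_eq_lintegral_rpow_enorm_toReal hp0 hp', ← hqdef, hqt,
      ← ENNReal.ofReal_rpow_of_nonneg (by positivity) ht0, ← hU]
    congr 1
    refine lintegral_congr_ae ?_
    filter_upwards [ae_dist0_pos h] with τ hτ
    rw [enorm_smul_cutPower 𝕜 hτ, ENNReal.ofReal_rpow_of_nonneg (by split_ifs <;> positivity) hq.le]
    congr 1
    split_ifs
    · rw [← Real.rpow_mul hτ.le]
      congr 1
      rw [hsdef]; linear_combination (-(n - k : ℝ)) * htq
    · exact Real.zero_rpow hq.ne'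
  -- The image outside the unit ball is discarded: it is not needed for a lower bound.
  have hran : ENNReal.ofReal (dualConst n k s * (sphereArea n / (ε * q)) ^ t) ≤
      eLpNorm (fun x : E n => ‖x‖ ^ (μ - k * t) • dualTransform h.le (cutPower 𝕜 n k s) x)
        p volume := by
    have hU := lintegral_norm_rpow_unitBall (F := E n) (by omega) hεq
    rw [hdn] at hU
    have e : ENNReal.ofReal (dualConst n k s * (sphereArea n / (ε * q)) ^ t) =
        (∫⁻ x : E n, ENNReal.ofReal (dualConst n k s ^ q) *
          ENNReal.ofReal (if ‖x‖ < 1 then ‖x‖ ^ (ε * q - n) else 0)) ^ t := by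
      rw [lintegral_const_mul' _ _ ENNReal.ofReal_ne_top, hU, ← ENNReal.ofReal_mul (by positivity),
        ENNReal.ofReal_rpow_of_nonneg (by positivity) ht0, Real.mul_rpow (by positivity)
        (by positivity), ← Real.rpow_mul hc.le, mul_comm q t, htq, Real.rpow_one]
    rw [e, eLpNorm_eq_lintegral_rpow_enorm_toReal hp0 hp', ← hqdef, hqt]
    refine ENNReal.rpow_le_rpow (lintegral_mono_ae ?_) ht0
    filter_upwards [Measure.ae_ne volume (0 : E n)] with x hx0
    have hx0 : 0 < ‖x‖ := norm_pos_iff.mpr hx0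
    by_cases hx : ‖x‖ < 1
    · rw [if_pos hx, dualTransform_cutPower 𝕜 h hs hx, enorm_rpow_smul hx0.le,
        ← ofReal_norm (RCLike.ofReal _), RCLike.norm_ofReal, abs_of_nonneg (by positivity),
        ← ENNReal.ofReal_mul (by positivity), ← ENNReal.ofReal_mul (by positivity),
        ENNReal.ofReal_rpow_of_nonneg (by positivity) hq.le]
      refine le_of_eq ?_
      congr 1
      rw [mul_left_comm, ← Real.rpow_add hx0, Real.mul_rpow hc.le (by positivity),
        ← Real.rpow_mul hx0.le]
      congr 2
      rw [hsdef]; linear_combination (n : ℝ) * htq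
    · rw [if_neg hx]
      simp
  have hb := eLpNorm_dualTransform_le_opNorm h p hμ (stronglyMeasurable_cutPower 𝕜 s)
    (by rw [hdom]; exact ENNReal.ofReal_lt_top)
  rw [hdom, ← ENNReal.ofReal_mul (norm_nonneg _)] at hb
  have hfin := (ENNReal.ofReal_le_ofReal_iff (by positivity)).mp (hran.trans hb)
  have e : sphereArea n / sphereArea (n - k) =
      (sphereArea n / (ε * q)) / (sphereArea (n - k) / (ε * q)) := by field_simp
  rw [e, Real.div_rpow (by positivity) (by positivity), ← mul_div_assoc, div_le_iff₀ (by positivity)]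
  exact hfin

/-- Both Gamma arguments stay positive, away from the poles, so `ε → 0` is allowed in the lower
bound. -/
theorem continuousAt_dualConst {a : ℝ} (ha : -((n : ℝ) - k) < a) :
    ContinuousAt (dualConst n k) a := by
  have hk : (0 : ℝ) ≤ k := by positivity
  have hp1 : 0 < ((n : ℝ) - k + a) / 2 := by linarith
  have hp2 : 0 < ((n : ℝ) + a) / 2 := by linarith
  have hG : ∀ {y : ℝ}, 0 < y → ContinuousAt Real.Gamma y := fun {y} hy =>
    (Real.differentiableAt_Gamma fun m => by
      have : (0 : ℝ) ≤ m := by positivity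
      linarith).continuousAt
  have c1 : ContinuousAt (fun a : ℝ => Real.Gamma (((n : ℝ) - k + a) / 2)) a :=
    ContinuousAt.comp (f := fun a : ℝ => ((n : ℝ) - k + a) / 2) (hG hp1) (by fun_prop)
  have c2 : ContinuousAt (fun a : ℝ => Real.Gamma (((n : ℝ) + a) / 2)) a :=
    ContinuousAt.comp (f := fun a : ℝ => ((n : ℝ) + a) / 2) (hG hp2) (by fun_prop)
  exact continuousAt_const.mul (c1.div c2 (Real.Gamma_pos_of_pos hp2).ne')

theorem norm_dualOperator (h : k < n) (p : ℝ≥0∞) [hp : Fact (1 ≤ p)] {μ : ℝ}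
    (hμ : μ < (n - k) * (1 - (p⁻¹).toReal)) :
    ‖dualOperator 𝕜 h p hμ‖ = dualNorm n k (p⁻¹).toReal μ := by
  refine le_antisymm (norm_dualOperator_le h p hμ) ?_
  rcases eq_or_ne p ∞ with rfl | hp'
  · exact le_norm_dualOperator_top h hμ
  · rw [dualNorm_eq h]
    set a : ℝ := -μ - (n - k) * (p⁻¹).toReal with ha
    have hc : ContinuousAt (fun ε : ℝ => dualConst n k (a + ε)) 0 := by
      refine ContinuousAt.comp (g := dualConst n k) (f := fun ε : ℝ => a + ε) ?_ (by fun_prop)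
      rw [add_zero]
      exact continuousAt_dualConst (by rw [ha]; linarith)
    have hlim := (hc.tendsto.mul_const
      ((sphereArea n / sphereArea (n - k)) ^ (p⁻¹).toReal)).mono_left
        (nhdsWithin_le_nhds (s := Set.Ioi 0))
    rw [add_zero] at hlim
    refine le_of_tendsto hlim ?_
    filter_upwards [self_mem_nhdsWithin] with ε hε
    exact dualConst_mul_le_norm_dualOperator h hp' hμ hε

end LowerBound

end KPlane

end

/-! ### The theorem in terms of the conjugate exponents. -/

theorem theorem3p8 (𝕜 : Type*) [RCLike 𝕜] (n k : ℕ) (hk : 1 ≤ k) (hkn : k < n)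
    (p p' : ℝ≥0∞) [Fact (1 ≤ p)] (hpp' : p⁻¹ + p'⁻¹ = 1)
    (μ ν : ℝ) (hν : ν = μ - k * (p⁻¹).toReal) (hμ : μ < (n - k) * (p'⁻¹).toReal) :
    ∃ T : KPlane.PlaneLp 𝕜 hkn.le p μ →L[𝕜] KPlane.SpaceLp 𝕜 n p ν,
      (∀ (F : KPlane.PlaneLp 𝕜 hkn.le p μ) (φ : KPlane.AffinePlane n k → 𝕜),
        φ =ᵐ[KPlane.planeMeasure hkn.le] F.1 →
          ∀ᵐ x : KPlane.E n,
            Integrable (fun γ => φ (KPlane.plane hkn.le γ x)) (KPlane.haarO n) ∧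
              (T F).1 x = KPlane.dualTransform hkn.le φ x) ∧
      ‖T‖ = Real.pi ^ ((k : ℝ) / 2) *
          (KPlane.sphereArea (n - k) / KPlane.sphereArea n) ^ (p'⁻¹).toReal *
        (Real.Gamma (((n - k) * (p'⁻¹).toReal - μ) / 2) /
          Real.Gamma ((n * (p'⁻¹).toReal + k * (p⁻¹).toReal - μ) / 2)) := by
  have h1 : p⁻¹ ≠ ∞ := ne_top_of_le_ne_top ENNReal.one_ne_top (hpp' ▸ le_self_add)
  have h2 : p'⁻¹ ≠ ∞ := ne_top_of_le_ne_top ENNReal.one_ne_top (hpp' ▸ le_add_self)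
  -- Conjugacy enters only as `1/p' = 1 - 1/p` in `ℝ`; the convention `1/∞ = 0` covers both
  -- endpoints.
  have ht : (p'⁻¹).toReal = 1 - (p⁻¹).toReal := by
    have := congrArg ENNReal.toReal hpp'
    rw [ENNReal.toReal_add h1 h2, ENNReal.toReal_one] at this
    linarith
  rw [ht] at hμ ⊢
  subst hν
  exact ⟨KPlane.dualOperator 𝕜 hkn p hμ, fun F φ hφ => KPlane.dualOperator_spec hkn p hμ F hφ,
    KPlane.norm_dualOperator hkn p hμ⟩
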